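/- Computations are arithmetic circuits (straight-line programs) over $\mathbb C$, where each addition, subtraction and multiplication counts as one operation, while inputs and complex constants are free; a separate circuit may be used for each group. Let $\omega$ be the exponent of matrix multiplication over $\mathbb C$, i.e. the infimum of all real $\tau$ such that, for a constant $C$ and all $n\ge 1$, the product of two $n\times n$ matrices can be computed with at most $C n^{\tau}$ operations. For a finite group $G$ let $\mathrm{Irr}(G)$ be a complete set of pairwise inequivalent irreducible complex representations of $G$, each written as matrices with respect to a chosen basis. The corresponding generalized DFT is the linear map that takes $c=(c_g)_{g\in G}\in\mathbb C[G]$ to $$\sum_{g\in G} c_g\cdot\bigoplus_{\rho\in \mathrm{Irr}(G)}\rho(g),$$ given by the entries of its diagonal blocks. **Theorem.** For every $\varepsilon>0$ there is a constant $c_\varepsilon$, depending only on $\varepsilon$, such that for every $n$ and every prime power $q$ the group $G=\mathrm{SL}_n(\mathbb F_q)$ has a generalized DFT using at most $c_\varepsilon\,|G|^{\omega/2+\varepsilon}$ operations. Precisely: complete sets $\mathrm{Irr}(G)$ exist, and for every choice of $\mathrm{Irr}(G)$ and of bases for its members, the corresponding generalized DFT can be computed with at most $c_\varepsilon\,|G|^{\omega/2+\varepsilon}$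 operations. -/

import Mathlib

/-! ### Arithmetic circuits (straight-line programs)

Programs over a field `K` with input variables indexed by `I`.  Every addition, subtraction and
multiplication counts as one operation; scalars from `K` and the inputs are available for free.
There are no divisions and no branching, and a separate program may be used for every input size
(the non-uniform model). -/

/-- The arithmetic operations a program may perform. -/
inductive ArithOp where
  | add
  | sub
  | mul

/-- The value of an arithmetic operation. -/
def ArithOp.eval {K : Type*} [Ring K] : ArithOp → K → K → K
  | .add, a, b => a + b
  | .sub, a, b => a - b
  | .mul, a, b => a * b

/-- What an instruction may refer to after `m` instructions have been carried out: a scalar, an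
input variable, or the result of one of the `m` earlier instructions. -/
inductive Operand (K I : Type*) (m : ℕ) where
  | scalar (c : K)
  | input (i : I)
  | result (t : Fin m)

/-- The value of an operand on the input `x`, given the results `r` of the earlier instructions. -/
def Operand.eval {K I : Type*} {m : ℕ} (x : I → K) (r : Fin m → K) : Operand K I m → K
  | .scalar c => c
  | .input i => x i
  | .result t => r t

/-- Straight-line programs, indexed by their number of operations. -/
inductive ArithProgram (K I : Type*) : ℕ → Type _ where
  | nil : ArithProgram K I 0
  | snoc {m : ℕ} (P : ArithProgram K I m) (op : ArithOp) (a b : Operand K I m) :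
      ArithProgram K I (m + 1)

/-- The results of all instructions of a program on the input `x`. -/
def ArithProgram.eval {K I : Type*} [Ring K] (x : I → K) :
    {m : ℕ} → ArithProgram K I m → Fin m → K
  | _, .nil => Fin.elim0
  | _, .snoc P op a b =>
      Fin.snoc (α := fun _ => K) (P.eval x) (op.eval (a.eval x (P.eval x)) (b.eval x (P.eval x)))

/-- The map `f`, from vectors indexed by `I` to vectors indexed by `O`, is computed by an
arithmetic circuit over `K` with at most `T` operations. -/
def ComputableWithin {K I O : Type*} [Ring K] (f : (I → K) → O → K) (T : ℝ) : Prop :=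
  ∃ (m : ℕ) (P : ArithProgram K I m) (out : O → Operand K I m),
    (m : ℝ) ≤ T ∧ ∀ x o, (out o).eval x (P.eval x) = f x o

/-! ### The exponent of matrix multiplication -/

/-- Multiplication of `n × n` matrices, as a map on the `2 n ^ 2` entries of the two factors. -/
def matMulMap (K : Type*) [Ring K] (n : ℕ) :
    ((Fin n × Fin n) ⊕ (Fin n × Fin n) → K) → Fin n × Fin n → K :=
  fun x p => ((Matrix.of fun i j => x (Sum.inl (i, j))) *
    (Matrix.of fun i j => x (Sum.inr (i, j))) : Matrix (Fin n) (Fin n) K) p.1 p.2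

/-- The exponent `ω` of matrix multiplication over `ℂ`: the infimum of all real `τ` such that
`n × n` matrices can be multiplied with `O(n ^ τ)` operations. -/
noncomputable def matMulExponent : ℝ :=
  sInf {τ : ℝ | ∃ C : ℝ, ∀ n : ℕ, 1 ≤ n → ComputableWithin (matMulMap ℂ n) (C * (n : ℝ) ^ τ)}

/-! ### Generalized discrete Fourier transforms -/

/-- A complete set of irreducible complex representations of `G`, each given on a coordinate space
(that is, with a choice of basis): every irreducible complex representation of `G` is equivalent
to exactly one member. -/
structure IrrepSystem (G : Type*) [Group G] where
  num : ℕ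
  dim : Fin num → ℕ
  rep : (i : Fin num) → Representation ℂ G (Fin (dim i) → ℂ)
  irreducible : ∀ i, (rep i).IsIrreducible
  inequivalent : ∀ i j, i ≠ j → IsEmpty ((rep i).Equiv (rep j))
  complete : ∀ (d : ℕ) (σ : Representation ℂ G (Fin d → ℂ)), σ.IsIrreducible →
    ∃ i, Nonempty (σ.Equiv (rep i))

/-- The generalized DFT `c ↦ ∑ g, c g • ⨁ ρ, ρ g`: the entry `(a, b)` of the block of `ρ i` is
`∑ g, c g * (ρ i g) a b`, where `ρ i g` is read as a matrix in the standard basis. -/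
noncomputable def IrrepSystem.dft {G : Type*} [Group G] [Fintype G] (R : IrrepSystem G) :
    (G → ℂ) → (Σ i : Fin R.num, Fin (R.dim i) × Fin (R.dim i)) → ℂ :=
  fun c p => (∑ g : G, c g • LinearMap.toMatrix' (R.rep p.1 g)) p.2.1 p.2.2

/-- `G` has a generalized DFT using at most `T` operations: complete sets of irreducible
representations exist, and for every choice of one (including the choice of bases) the
corresponding DFT has an arithmetic circuit with at most `T` operations. -/
def HasGeneralizedDFT (G : Type*) [Group G] [Fintype G] (T : ℝ) : Prop :=
  Nonempty (IrrepSystem G) ∧ ∀ R : IrrepSystem G, ComputableWithin R.dft T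

/-! ### Sets of functions obtained by straight-line computations -/

/-! Let α slightly exceed ω/2, so that D × D matrices multiply in O(D^{2α}) operations. The heart is
a reduction (`cost_dft_product`): if A and B map to G so that (a, b) ↦ φ(a)ψ(b) is injective, the
DFT of a function supported on a translate of φ(A)ψ(B) costs |B| T_A + |A| T_B + O(|G|^α). Partial
DFTs over A and then over B give all sums Σ c(a,b) σ(a) ⊗ τ(b). For an irreducible ρ of G, take a
basis adapted to A on the left and one adapted to B on the right: each block of Σ c(a,b) ρ(φ(a)ψ(b))
is the image, under such a sum, of a block of the constant change-of-basis matrix. For fixed (σ, τ)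
the blocks coming from all ρ are N columns to be multiplied by one square matrix of size D = dim σ ·
dim τ. Since Σ N D = Σ (dim ρ)² and Σ D² are both at most |G|, these products cost O(|G|^α) in
total, as do the base changes back.

Because |A||B| ≤ |G|, the constants in front of |G|^α only add up under such a factorization, and
are multiplied by the number of translates needed to cover G (`DFTRate.of_cover`). In SL_{n+1}(F_q)
the matrices with nonzero corner entry form the product of an abelian group of lower unipotent
matrices and the stabilizer P of a line; n + 1 translates of this cell cover the group. P factors
exactly into a torus F_q^×, SL_n(F_q) and F_q^n. Abelian groups reduce to cyclic ones, where
Bluestein's algorithm and the FFT apply.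

The constants thus satisfy t_{n+1} ≤ (n+1)(t_n + O(n log q)), whence t_n = O((n+2)! log q). For n ≥
2 the bound |SL_n(F_q)| ≥ q^{n(n-1)} absorbs this into |G|^{ε/2}, uniformly in n and q; for n ≤ 1
the group is trivial. -/

/-- The constant functions. -/
def constFuns (X K : Type*) : Set (X → K) := Set.range fun c _ => c

/-- `Reach B m B'`: starting from the functions in `B` and the constants, `m` operations
produce the set `B'` of functions. -/
inductive Reach {X K : Type*} [Ring K] (B : Set (X → K)) : ℕ → Set (X → K) → Prop
  | refl : Reach B 0 B
  | step {m : ℕ} {B' : Set (X → K)} (h : Reach B m B') (op : ArithOp) {a b : X → K}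
      (ha : a ∈ B' ∪ constFuns X K) (hb : b ∈ B' ∪ constFuns X K) :
      Reach B (m + 1) (insert (fun x => op.eval (a x) (b x)) B')

/-- All functions in `E` can be computed from the functions in `B` and the constants with at most
`T` operations. -/
def Cost {X K : Type*} [Ring K] (B : Set (X → K)) (T : ℝ) (E : Set (X → K)) : Prop :=
  ∃ (m : ℕ) (B' : Set (X → K)), Reach B m B' ∧ (m : ℝ) ≤ T ∧ E ⊆ B' ∪ constFuns X K

theorem const_mem_constFuns {X K : Type*} (c : K) : (fun _ : X => c) ∈ constFuns X K := ⟨c, rfl⟩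

section Circuits

variable {X K : Type*} [Ring K]

theorem Reach.subset {B B' : Set (X → K)} {m : ℕ} (h : Reach B m B') : B ⊆ B' := by
  induction h with
  | refl => exact subset_rfl
  | step h op ha hb ih => exact ih.trans (Set.subset_insert _ _)

theorem Reach.trans {B B' B'' : Set (X → K)} {m n : ℕ} (h : Reach B m B')
    (h' : Reach B' n B'') : Reach B (m + n) B'' := by
  induction h' with
  | refl => exact h
  | step _ op ha hb ih => exact ih.step op ha hb

theorem Reach.mono {B D B' : Set (X → K)} {m : ℕ} (h : Reach B m B')
    (hBD : B ⊆ D ∪ constFuns X K) :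
    ∃ D', Reach D m D' ∧ B' ⊆ D' ∪ constFuns X K := by
  induction h with
  | refl => exact ⟨D, .refl, hBD⟩
  | @step m B' h op a b ha hb ih =>
    obtain ⟨D', hD, hB⟩ := ih
    have key : ∀ a, a ∈ B' ∪ constFuns X K → a ∈ D' ∪ constFuns X K := fun a ha =>
      ha.elim (fun h => hB h) Or.inr
    refine ⟨_, hD.step op (key a ha) (key b hb), ?_⟩
    rintro f (rfl | hf)
    · exact Or.inl (Set.mem_insert _ _)
    · exact (hB hf).imp (fun h => Set.mem_insert_of_mem _ h) id

/-- Substitution of functions for the inputs commutes with every operation; this is what lets a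
circuit serve as a subroutine. -/
theorem Reach.pullback {Y : Type*} {B B' : Set (X → K)} {m : ℕ} (h : Reach B m B')
    (φ : Y → X) : Reach ((fun f => f ∘ φ) '' B) m ((fun f => f ∘ φ) '' B') := by
  induction h with
  | refl => exact .refl
  | @step m B' h op a b ha hb ih =>
    have key : ∀ a, a ∈ B' ∪ constFuns X K →
        a ∘ φ ∈ ((fun f => f ∘ φ) '' B') ∪ constFuns Y K := by
      rintro a (ha | ⟨c, rfl⟩)
      · exact Or.inl ⟨a, ha, rfl⟩
      · exact Or.inr ⟨c, rfl⟩
    rw [Set.image_insert_eq]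
    exact ih.step op (key a ha) (key b hb)

namespace Cost

variable {B D E F : Set (X → K)} {S T : ℝ}

theorem of_subset (h : E ⊆ B ∪ constFuns X K) : Cost B 0 E := ⟨0, B, .refl, by simp, h⟩

theorem mono (h : Cost B S E) (hST : S ≤ T) (hF : F ⊆ E) : Cost B T F :=
  let ⟨m, B', h1, h2, h3⟩ := h
  ⟨m, B', h1, h2.trans hST, hF.trans h3⟩

theorem mono_time (h : Cost B S E) (hST : S ≤ T) : Cost B T E := h.mono hST subset_rfl

theorem mono_base (h : Cost B S E) (hBD : B ⊆ D ∪ constFuns X K) : Cost D S E := by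
  obtain ⟨m, B', h1, h2, h3⟩ := h
  obtain ⟨D', h4, h5⟩ := h1.mono hBD
  exact ⟨m, D', h4, h2, h3.trans (Set.union_subset h5 Set.subset_union_right)⟩

theorem with_base (h : Cost B S E) : Cost B S (B ∪ E) := by
  obtain ⟨m, B', h1, h2, h3⟩ := h
  exact ⟨m, B', h1, h2, Set.union_subset (h1.subset.trans Set.subset_union_left) h3⟩

theorem trans (h : Cost B S E) (h' : Cost E T F) : Cost B (S + T) F := by
  obtain ⟨m, B', h1, h2, h3⟩ := h
  obtain ⟨n, D, h4, h5, h6⟩ := h'.mono_base h3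
  exact ⟨m + n, D, h1.trans h4, by push_cast; linarith, h6⟩

theorem union (h : Cost B S E) (h' : Cost B T F) : Cost B (S + T) (E ∪ F) := by
  have h1 : Cost (B ∪ E) T (E ∪ F) :=
    (h'.mono_base (D := B ∪ E) (fun f hf => Or.inl (Or.inl hf))).with_base.mono le_rfl
      (Set.union_subset_union_left _ Set.subset_union_right)
  exact h.with_base.trans h1

theorem biUnion {J : Type*} (s : Finset J) {T : J → ℝ} {E : J → Set (X → K)}
    (h : ∀ j ∈ s, Cost B (T j) (E j)) : Cost B (∑ j ∈ s, T j) (⋃ j ∈ s, E j) := by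
  classical
  induction s using Finset.induction_on with
  | empty => simpa using of_subset (Set.empty_subset _)
  | insert a s ha ih =>
    rw [Finset.sum_insert ha, Finset.set_biUnion_insert]
    exact (h a (Finset.mem_insert_self _ _)).union
      (ih fun j hj => h j (Finset.mem_insert_of_mem hj))

theorem iUnion {J : Type*} [Fintype J] {T : J → ℝ} {E : J → Set (X → K)}
    (h : ∀ j, Cost B (T j) (E j)) : Cost B (∑ j, T j) (⋃ j, E j) := by
  simpa using biUnion Finset.univ fun j _ => h j

theorem op (o : ArithOp) {a b : X → K} (ha : a ∈ B ∪ constFuns X K)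
    (hb : b ∈ B ∪ constFuns X K) : Cost B 1 {fun x => o.eval (a x) (b x)} :=
  ⟨1, _, Reach.refl.step o ha hb, by simp, by simp⟩

theorem add {a b : X → K} (ha : a ∈ B ∪ constFuns X K) (hb : b ∈ B ∪ constFuns X K) :
    Cost B 1 {fun x => a x + b x} := op .add ha hb

theorem mul {a b : X → K} (ha : a ∈ B ∪ constFuns X K) (hb : b ∈ B ∪ constFuns X K) :
    Cost B 1 {fun x => a x * b x} := op .mul ha hb

theorem sum {J : Type*} (s : Finset J) {v : J → X → K}
    (h : ∀ j ∈ s, v j ∈ B ∪ constFuns X K) : Cost B s.card {fun x => ∑ j ∈ s, v j x} := by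
  classical
  induction s using Finset.induction_on with
  | empty =>
    simp only [Finset.sum_empty, Finset.card_empty, Nat.cast_zero]
    exact of_subset (Set.singleton_subset_iff.2 (Or.inr (const_mem_constFuns 0)))
  | insert a s ha ih =>
    rw [Finset.card_insert_of_notMem ha]
    simp only [Finset.sum_insert ha]
    have h1 := (ih fun j hj => h j (Finset.mem_insert_of_mem hj)).with_base
    push_cast
    refine h1.trans (add ?_ (Or.inl (Or.inr rfl)))
    exact (h a (Finset.mem_insert_self _ _)).imp Or.inl id

/-- If every function of the family `e` is computed with at most `t` operations. -/
theorem range_of_forall {J : Type*} [Fintype J] {e : J → X → K} {t : ℝ}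
    (h : ∀ j, Cost B t {e j}) : Cost B (Fintype.card J * t) (Set.range e) := by
  have := iUnion h
  simpa [Set.iUnion_singleton_eq_range] using this

end Cost

/-! ### Programs versus reachable sets of functions -/

theorem Operand.eval_lift {K I : Type*} {m : ℕ} (a : Operand K I m) : ∃ a' : Operand K I (m + 1), ∀ (x : I → K) (r : Fin m → K) (v : K),
      a'.eval x (Fin.snoc (α := fun _ => K) r v) = a.eval x r := by
  cases a with
  | scalar c => exact ⟨.scalar c, fun _ _ _ => rfl⟩
  | input i => exact ⟨.input i, fun _ _ _ => rfl⟩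
  | result t => exact ⟨.result t.castSucc, fun _ _ _ => by simp [Operand.eval]⟩

/-- The coordinate functions. -/
def coordFuns (I K : Type*) : Set ((I → K) → K) := Set.range fun i x => x i

theorem ArithProgram.reach {I : Type*} {m : ℕ} (P : ArithProgram K I m) :
    ∃ B', Reach (coordFuns I K) m B' ∧
      ∀ a : Operand K I m, (fun x => a.eval x (P.eval x)) ∈ B' ∪ constFuns _ K := by
  induction P with
  | nil =>
    refine ⟨_, .refl, fun a => ?_⟩
    cases a with
    | scalar c => exact Or.inr ⟨c, rfl⟩
    | input i => exact Or.inl ⟨i, rfl⟩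
    | result t => exact t.elim0
  | snoc P op a b ih =>
    obtain ⟨B', h, hB⟩ := ih
    have h' := h.step op (hB a) (hB b)
    refine ⟨_, h', fun c => ?_⟩
    cases c with
    | scalar c => exact Or.inr ⟨c, rfl⟩
    | input i => exact Or.inl (h'.subset ⟨i, rfl⟩)
    | result t =>
      refine Fin.lastCases ?_ (fun t => ?_) t
      · left; left
        funext x
        simp [Operand.eval, ArithProgram.eval]
      · have := hB (.result t)
        simp only [Operand.eval, ArithProgram.eval, Fin.snoc_castSucc] at this ⊢
        exact this.imp (fun h => Set.mem_insert_of_mem _ h) id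

theorem Reach.program {I : Type*} {m : ℕ} {B' : Set ((I → K) → K)}
    (h : Reach (coordFuns I K) m B') :
    ∃ P : ArithProgram K I m, ∀ f ∈ B' ∪ constFuns _ K,
      ∃ a : Operand K I m, ∀ x, a.eval x (P.eval x) = f x := by
  induction h with
  | refl =>
    refine ⟨.nil, ?_⟩
    rintro f (⟨i, rfl⟩ | ⟨c, rfl⟩)
    · exact ⟨.input i, fun _ => rfl⟩
    · exact ⟨.scalar c, fun _ => rfl⟩
  | step h op ha hb ih =>
    obtain ⟨P, hP⟩ := ih
    obtain ⟨a', ha'⟩ := hP _ ha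
    obtain ⟨b', hb'⟩ := hP _ hb
    refine ⟨.snoc P op a' b', ?_⟩
    rintro f ((rfl | hf) | hf)
    · refine ⟨.result (Fin.last _), fun x => ?_⟩
      have e := congrArg₂ op.eval (ha' x) (hb' x)
      simpa only [Operand.eval, ArithProgram.eval, Fin.snoc_last] using e
    all_goals
      obtain ⟨c, hc⟩ := hP f (by first | exact Or.inl hf | exact Or.inr hf)
      obtain ⟨c', hc'⟩ := c.eval_lift
      exact ⟨c', fun x => by rw [← hc x]; exact hc' _ _ _⟩

/-- The translation has no overhead in either direction, so all circuits below are built by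
composing `Cost` bounds. -/
theorem computableWithin_iff_cost {I O : Type*} {f : (I → K) → O → K} {T : ℝ} :
    ComputableWithin f T ↔ Cost (coordFuns I K) T (Set.range fun o x => f x o) := by
  constructor
  · rintro ⟨m, P, out, hm, h⟩
    obtain ⟨B', h1, h2⟩ := P.reach
    refine ⟨m, B', h1, hm, ?_⟩
    rintro _ ⟨o, rfl⟩
    simpa only [h] using h2 (out o)
  · rintro ⟨m, B', h1, hm, h2⟩
    obtain ⟨P, hP⟩ := h1.program
    choose out hout using fun o => hP _ (h2 ⟨o, rfl⟩)
    exact ⟨m, P, out, hm, fun x o => hout o x⟩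

theorem Cost.of_computableWithin {I O : Type*} {f : (I → K) → O → K} {T : ℝ}
    (hf : ComputableWithin f T) {B : Set (X → K)} {u : I → X → K}
    (hu : ∀ i, u i ∈ B ∪ constFuns X K) :
    Cost B T (Set.range fun o x => f (fun i => u i x) o) := by
  obtain ⟨m, B', h1, hm, h2⟩ := computableWithin_iff_cost.1 hf
  have h3 := h1.pullback (fun (x : X) (i : I) => u i x)
  have h4 : Cost ((fun f => f ∘ fun (x : X) (i : I) => u i x) '' coordFuns I K) T
      (Set.range fun o x => f (fun i => u i x) o) := by
    refine ⟨m, _, h3, hm, ?_⟩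
    rintro _ ⟨o, rfl⟩
    obtain h | ⟨c, hc⟩ := h2 ⟨o, rfl⟩
    · exact Or.inl ⟨_, h, rfl⟩
    · exact Or.inr ⟨c, funext fun x => congrFun hc _⟩
  refine h4.mono_base ?_
  rintro _ ⟨_, ⟨i, rfl⟩, rfl⟩
  exact hu i

end Circuits

/-! ### Matrix multiplication -/

/-- `n × n` matrices can be multiplied with at most `C * n ^ a` operations. -/
def MatMulRate (C a : ℝ) : Prop :=
  ∀ n : ℕ, 1 ≤ n → ComputableWithin (matMulMap ℂ n) (C * (n : ℝ) ^ a)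

theorem matMulMap_apply (n : ℕ) (x : (Fin n × Fin n) ⊕ (Fin n × Fin n) → ℂ) (p : Fin n × Fin n) :
    matMulMap ℂ n x p = ∑ k, x (Sum.inl (p.1, k)) * x (Sum.inr (k, p.2)) := by
  simp [matMulMap, Matrix.mul_apply]

theorem matMulRate_three : MatMulRate 2 3 := by
  intro n _
  rw [computableWithin_iff_cost]
  set B := coordFuns ((Fin n × Fin n) ⊕ (Fin n × Fin n)) ℂ
  have h1 : Cost B (Fintype.card (Fin n × Fin n × Fin n) * 1)
      (Set.range fun (p : Fin n × Fin n × Fin n) x =>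
        x (Sum.inl (p.1, p.2.1)) * x (Sum.inr (p.2.1, p.2.2))) := by
    refine Cost.range_of_forall fun p => Cost.mul ?_ ?_
    · exact Or.inl ⟨Sum.inl (p.1, p.2.1), rfl⟩
    · exact Or.inl ⟨Sum.inr (p.2.1, p.2.2), rfl⟩
  have h2 := h1.trans (T := Fintype.card (Fin n × Fin n) * n)
    (F := Set.range fun p x => matMulMap ℂ n x p) (by
      refine Cost.range_of_forall fun p => ?_
      simp only [matMulMap_apply]
      have := Cost.sum (B := Set.range fun (p : Fin n × Fin n × Fin n)
        (x : (Fin n × Fin n) ⊕ (Fin n × Fin n) → ℂ) =>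
        x (Sum.inl (p.1, p.2.1)) * x (Sum.inr (p.2.1, p.2.2))) Finset.univ
        (v := fun k x => x (Sum.inl (p.1, k)) * x (Sum.inr (k, p.2)))
        (fun k _ => Or.inl ⟨(p.1, k, p.2), rfl⟩)
      simpa using this)
  refine h2.mono_time (le_of_eq ?_)
  have : ((n : ℝ) ^ (3 : ℝ)) = (n : ℝ) ^ (3 : ℕ) := by exact_mod_cast Real.rpow_natCast (n : ℝ) 3
  rw [this]
  simp
  ring

/-- The entries of a product are pairwise distinct functions, none of them a constant or an input,
so they need n² different instructions. -/
theorem sq_le_of_computableWithin_matMulMap {n : ℕ} {T : ℝ}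
    (h : ComputableWithin (matMulMap ℂ n) T) : (n : ℝ) ^ 2 ≤ T := by
  obtain ⟨m, P, out, hm, h⟩ := h
  -- For p = (i, j) these are the matrix units E_ii and E_ij, with product E_ij; replacing either by
  -- zero kills the product.
  let A : Fin n × Fin n → Fin n × Fin n → ℂ := fun p q => if q = (p.1, p.1) then 1 else 0
  let B : Fin n × Fin n → Fin n × Fin n → ℂ := fun p q => if q = (p.1, p.2) then 1 else 0
  have hAB : ∀ p q, matMulMap ℂ n (Sum.elim (A p) (B p)) q = if q = p then 1 else 0 := by
    rintro ⟨i, j⟩ ⟨k, l⟩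
    by_cases hk : k = i <;> by_cases hl : l = j <;>
      simp [matMulMap_apply, A, B, hk, hl]
  have hA0 : ∀ p q, matMulMap ℂ n (Sum.elim (A p) 0) q = 0 := by
    intro p q; simp [matMulMap_apply]
  have h0B : ∀ p q, matMulMap ℂ n (Sum.elim 0 (B p)) q = 0 := by
    intro p q; simp [matMulMap_apply]
  have key : ∀ p, ∃ t, out p = .result t := by
    intro p
    have e1 := (h (Sum.elim (A p) (B p)) p).trans (hAB p p)
    have e2 := (h (Sum.elim (A p) 0) p).trans (hA0 p p)
    have e3 := (h (Sum.elim 0 (B p)) p).trans (h0B p p)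
    rw [if_pos rfl] at e1
    cases ho : out p with
    | result t => exact ⟨t, rfl⟩
    | scalar c =>
      simp only [ho, Operand.eval] at e1 e2
      exact absurd (e1.symm.trans e2) one_ne_zero
    | input i =>
      simp only [ho, Operand.eval] at e1 e2 e3
      cases i with
      | inl q => exact absurd (e1.symm.trans e2) one_ne_zero
      | inr q => exact absurd (e1.symm.trans e3) one_ne_zero
  choose t ht using key
  have hinj : Function.Injective t := by
    intro p q hpq
    have e1 := (h (Sum.elim (A p) (B p)) p).trans (hAB p p)
    have e2 := (h (Sum.elim (A p) (B p)) q).trans (hAB p q)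
    rw [ht, hpq, ← ht q, e2] at e1
    by_contra hne
    simp [Ne.symm hne] at e1
  have := Fintype.card_le_of_injective t hinj
  simp only [Fintype.card_prod, Fintype.card_fin] at this
  refine le_trans ?_ hm
  rw [sq]
  exact_mod_cast this

theorem MatMulRate.two_le {C a : ℝ} (h : MatMulRate C a) : 2 ≤ a := by
  by_contra! ha
  have h1 : ∀ n : ℕ, 1 ≤ n → (n : ℝ) ^ (2 - a) ≤ C := by
    intro n hn
    have hn' : (0 : ℝ) < n := by exact_mod_cast hn
    have := sq_le_of_computableWithin_matMulMap (h n hn)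
    rw [Real.rpow_sub hn', div_le_iff₀ (Real.rpow_pos_of_pos hn' _)]
    exact_mod_cast this
  have h2 := (tendsto_rpow_atTop (show 0 < 2 - a by linarith)).comp
    (tendsto_natCast_atTop_atTop (R := ℝ))
  obtain ⟨n, hn, hn'⟩ := ((h2.eventually_gt_atTop C).and (Filter.eventually_ge_atTop 1)).exists
  exact absurd (h1 n hn') (not_le.2 hn)

theorem two_le_matMulExponent : 2 ≤ matMulExponent :=
  by
  refine le_csInf ⟨3, 2, matMulRate_three⟩ ?_
  rintro τ ⟨C, h⟩
  exact MatMulRate.two_le h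

theorem exists_matMulRate {a : ℝ} (ha : matMulExponent < a) : ∃ C, 1 ≤ C ∧ MatMulRate C a := by
  obtain ⟨τ, ⟨C, hC⟩, hτ⟩ := exists_lt_of_csInf_lt
    (show {τ : ℝ | ∃ C, MatMulRate C τ}.Nonempty from ⟨3, 2, matMulRate_three⟩) ha
  -- Having `1 ≤ C` lets later linear terms be absorbed into C |G|^α.
  refine ⟨max C 1, le_max_right _ _, fun n hn => ?_⟩
  have hn' : (1 : ℝ) ≤ n := by exact_mod_cast hn
  obtain ⟨m, P, out, hm, h⟩ := hC n hn
  refine ⟨m, P, out, hm.trans ?_, h⟩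
  gcongr
  · exact le_max_left _ _

section

variable {X : Type*} {ι κ μ : Type*} [Fintype ι] [Fintype κ] [Fintype μ]

/-- The entries of the product of two matrices of functions. -/
def mulEntries (a : ι → κ → X → ℂ) (b : κ → μ → X → ℂ) : Set (X → ℂ) :=
  Set.range fun (p : ι × μ) x => ∑ k, a p.1 k x * b k p.2 x

/-- The missing columns are padded with zeros, which are free constants. -/
theorem Cost.mulEntries_of_card_le {C r : ℝ} (h : MatMulRate C r) (hD : 1 ≤ Fintype.card ι)
    (hι : Fintype.card κ = Fintype.card ι) (hμ : Fintype.card μ ≤ Fintype.card ι)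
    {B : Set (X → ℂ)} {a : ι → κ → X → ℂ} {b : κ → μ → X → ℂ}
    (ha : ∀ i k, a i k ∈ B ∪ constFuns X ℂ) (hb : ∀ k j, b k j ∈ B ∪ constFuns X ℂ) :
    Cost B (C * (Fintype.card ι : ℝ) ^ r) (mulEntries a b) := by
  set D := Fintype.card ι
  let e₁ : ι ≃ Fin D := Fintype.equivFin ι
  let e₂ : κ ≃ Fin D := Fintype.equivFinOfCardEq hι
  obtain ⟨e₃⟩ : Nonempty (μ ↪ Fin D) := Function.Embedding.nonempty_of_card_le (by simpa using hμ)
  let u : (Fin D × Fin D) ⊕ (Fin D × Fin D) → X → ℂ := Sum.elim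
    (fun p => a (e₁.symm p.1) (e₂.symm p.2))
    (fun p => Function.extend e₃ (b (e₂.symm p.1)) 0 p.2)
  have hu : ∀ i, u i ∈ B ∪ constFuns X ℂ := by
    rintro (p | p)
    · exact ha _ _
    · simp only [u, Sum.elim_inr]
      by_cases hp : ∃ j, e₃ j = p.2
      · obtain ⟨j, hj⟩ := hp
        rw [← hj, e₃.injective.extend_apply]
        exact hb _ _
      · rw [Function.extend_apply' _ _ _ hp]
        exact Or.inr (const_mem_constFuns 0)
  refine (Cost.of_computableWithin (h D hD) hu).mono le_rfl ?_
  rintro _ ⟨p, rfl⟩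
  refine ⟨(e₁ p.1, e₃ p.2), funext fun x => ?_⟩
  simp only [matMulMap_apply, u, Sum.elim_inl, Sum.elim_inr, e₃.injective.extend_apply,
    Equiv.symm_apply_apply]
  exact e₂.symm.sum_comp fun k => a p.1 k x * b k p.2 x

/-- The cost of multiplying a square matrix by a rectangular one. -/
theorem Cost.mulEntries {C r : ℝ} (hC : 0 ≤ C) (h : MatMulRate C r)
    (hι : Fintype.card κ = Fintype.card ι)
    {B : Set (X → ℂ)} {a : ι → κ → X → ℂ} {b : κ → μ → X → ℂ}
    (ha : ∀ i k, a i k ∈ B ∪ constFuns X ℂ) (hb : ∀ k j, b k j ∈ B ∪ constFuns X ℂ) :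
    Cost B (((Fintype.card μ : ℝ) / Fintype.card ι + 1) * (C * (Fintype.card ι : ℝ) ^ r))
      (mulEntries a b) := by
  classical
  obtain hD | hD := Nat.eq_zero_or_pos (Fintype.card ι)
  · have : IsEmpty ι := Fintype.card_eq_zero_iff.1 hD
    refine (Cost.of_subset (E := ∅) (Set.empty_subset _)).mono (by positivity) ?_
    rintro _ ⟨p, rfl⟩
    exact isEmptyElim p.1
  set D := Fintype.card ι with hDdef
  set N := Fintype.card μ with hN
  let e : μ ≃ Fin N := Fintype.equivFin μ
  let J := Fin (N / D + 1)
  -- Cut the N columns into groups of at most D by the quotient of their index by D; the remainder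
  -- is injective on each group. Quotients range up to N / D, hence the extra group.
  let part : J → Type _ := fun t => {j : μ // (e j : ℕ) / D = t}
  have hpart : ∀ t, Fintype.card (part t) ≤ Fintype.card ι := by
    intro t
    have hinj : Function.Injective (fun j : part t => (⟨(e j.1 : ℕ) % D, Nat.mod_lt _ hD⟩ : Fin D)) := by
      intro j k hjk
      have h1 : (e j.1 : ℕ) % D = (e k.1 : ℕ) % D := congrArg Fin.val hjk
      have h2 : (e j.1 : ℕ) / D = (e k.1 : ℕ) / D := j.2.trans k.2.symm
      apply Subtype.ext
      apply e.injective
      apply Fin.ext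
      rw [← Nat.div_add_mod (e j.1 : ℕ) D, ← Nat.div_add_mod (e k.1 : ℕ) D, h1, h2]
    simpa using Fintype.card_le_of_injective _ hinj
  have key := Cost.iUnion (J := J) (B := B) fun t =>
    Cost.mulEntries_of_card_le h hD hι (hpart t) ha (b := fun k (j : part t) => b k j.1)
      (fun k j => hb k j.1)
  refine key.mono ?_ ?_
  · rw [Finset.sum_const, nsmul_eq_mul, Finset.card_univ, Fintype.card_fin]
    gcongr
    push_cast
    gcongr
    exact Nat.cast_div_le
  · rintro _ ⟨⟨i, j⟩, rfl⟩
    refine Set.mem_iUnion.2 ⟨⟨(e j : ℕ) / D, ?_⟩, ⟨(i, ⟨j, rfl⟩), rfl⟩⟩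
    exact Nat.lt_succ_of_le (Nat.div_le_div_right (e j).2.le)

end

/-! ### Complex representations of finite groups -/

namespace Representation

open scoped MonoidAlgebra

theorem IsIrreducible.congr {k G V W : Type*} [Field k] [Monoid G] [AddCommGroup V] [Module k V]
    [AddCommGroup W] [Module k W] {ρ : Representation k G V} {σ : Representation k G W}
    (e : ρ.Equiv σ) (h : ρ.IsIrreducible) : σ.IsIrreducible := by
  rw [irreducible_iff_isSimpleModule_asModule] at h ⊢
  let f := IntertwiningMap.equivLinearMapAsModule ρ σ e.toIntertwiningMap
  have hf : Function.Bijective f := e.toLinearEquiv.bijective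
  exact IsSimpleModule.congr (LinearEquiv.ofBijective f hf).symm

theorem IsIrreducible.pos_dim {k G : Type*} [Field k] [Monoid G] {d : ℕ}
    {ρ : Representation k G (Fin d → k)} (h : ρ.IsIrreducible) : 0 < d := by
  rcases Nat.eq_zero_or_pos d with rfl | hd
  · exfalso
    obtain ⟨x, y, hxy⟩ := h.toNontrivial
    apply hxy
    ext v
    have hv : v = 0 := Subsingleton.elim _ _
    have hx : (0 : Fin 0 → k) ∈ x := x.toSubmodule.zero_mem
    have hy : (0 : Fin 0 → k) ∈ y := y.toSubmodule.zero_mem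
    rw [hv]
    exact iff_of_true hx hy
  · exact hd

section Orthogonality

variable {G : Type*} [Group G]

/-- The matrix of `ρ g` in the standard basis. -/
noncomputable abbrev mat {d : ℕ} (ρ : Representation ℂ G (Fin d → ℂ)) (g : G) :
    Matrix (Fin d) (Fin d) ℂ := LinearMap.toMatrix' (ρ g)

theorem mat_mul {d : ℕ} (ρ : Representation ℂ G (Fin d → ℂ)) (g h : G) :
    ρ.mat (g * h) = ρ.mat g * ρ.mat h := by
  simp [mat, LinearMap.toMatrix'_mul]

theorem mat_one {d : ℕ} (ρ : Representation ℂ G (Fin d → ℂ)) : ρ.mat 1 = 1 := by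
  simp [mat, LinearMap.toMatrix'_one]

variable [Fintype G]

/-- The average of `X` over `G`. -/
noncomputable def avgMap {d e : ℕ} (ρ : Representation ℂ G (Fin d → ℂ))
    (σ : Representation ℂ G (Fin e → ℂ)) (X : (Fin e → ℂ) →ₗ[ℂ] (Fin d → ℂ)) :
    IntertwiningMap σ ρ where
  toLinearMap := ∑ g : G, ρ g ∘ₗ X ∘ₗ σ g⁻¹
  isIntertwining' := by
    intro h
    refine LinearMap.ext fun v => ?_
    change (∑ g : G, ρ g ∘ₗ X ∘ₗ σ g⁻¹) (σ h v) = ρ h ((∑ g : G, ρ g ∘ₗ X ∘ₗ σ g⁻¹) v)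
    simp only [LinearMap.sum_apply, map_sum]
    refine Fintype.sum_equiv (Equiv.mulLeft h⁻¹) _ _ fun g => ?_
    simp only [LinearMap.comp_apply, Equiv.coe_mulLeft, mul_inv_rev, inv_inv, map_mul,
      Module.End.mul_apply]
    rw [← Module.End.mul_apply (ρ h), ← map_mul, mul_inv_cancel, map_one, Module.End.one_apply]

/-- Averaging a matrix unit produces the correlations of matrix coefficients, so Schur's lemma for
`avgMap` becomes the orthogonality relations. -/
theorem avgMap_entry {d e : ℕ} (ρ : Representation ℂ G (Fin d → ℂ))
    (σ : Representation ℂ G (Fin e → ℂ)) (b : Fin d) (c : Fin e) (a : Fin d) (f : Fin e) :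
    LinearMap.toMatrix' (avgMap ρ σ (Matrix.toLin' (Matrix.single b c 1))).toLinearMap a f =
      ∑ g : G, ρ.mat g a b * σ.mat g⁻¹ c f := by
  simp only [avgMap, map_sum, LinearMap.toMatrix'_comp, LinearMap.toMatrix'_toLin',
    Matrix.sum_apply]
  refine Finset.sum_congr rfl fun g _ => ?_
  rw [Matrix.mul_apply, Finset.sum_eq_single b]
  · rw [Matrix.mul_apply, Finset.sum_eq_single c]
    · simp
    · intro k _ hk; simp [hk.symm]
    · simp
  · intro k _ hk
    rw [Matrix.mul_apply, Finset.sum_eq_zero, mul_zero]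
    intro l _
    simp [hk.symm]
  · simp

theorem sum_mat_mul_mat_of_isEmpty {d e : ℕ} {ρ : Representation ℂ G (Fin d → ℂ)}
    {σ : Representation ℂ G (Fin e → ℂ)} (hρ : ρ.IsIrreducible) (hσ : σ.IsIrreducible)
    (h : IsEmpty (σ.Equiv ρ)) (a b : Fin d) (c f : Fin e) :
    ∑ g : G, ρ.mat g a b * σ.mat g⁻¹ c f = 0 := by
  rw [← avgMap_entry, Subsingleton.elim (avgMap ρ σ _) 0]
  simp

theorem sum_mat_mul_mat_self {d : ℕ} {ρ : Representation ℂ G (Fin d → ℂ)}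
    (hρ : ρ.IsIrreducible) (a b c f : Fin d) :
    ∑ g : G, ρ.mat g a b * ρ.mat g⁻¹ c f =
      if a = f ∧ b = c then (Fintype.card G : ℂ) / d else 0 := by
  obtain ⟨l, hl⟩ := IsIrreducible.algebraMap_intertwiningMap_bijective_of_isAlgClosed.surjective
    (avgMap ρ ρ (Matrix.toLin' (Matrix.single b c 1)))
  have key : ∀ a f, ∑ g : G, ρ.mat g a b * ρ.mat g⁻¹ c f = if a = f then l else 0 := by
    intro a f
    rw [← avgMap_entry, ← hl]
    have : (algebraMap ℂ (IntertwiningMap ρ ρ) l).toLinearMap = l • LinearMap.id := rfl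
    rw [this, map_smul, LinearMap.toMatrix'_id]
    simp [Matrix.one_apply]
  -- Schur's lemma makes the average a scalar l; its trace determines l.
  have htr : (d : ℂ) * l = if b = c then (Fintype.card G : ℂ) else 0 := by
    have h1 : ∑ a : Fin d, ∑ g : G, ρ.mat g a b * ρ.mat g⁻¹ c a = d * l := by
      simp only [key]
      simp
    rw [← h1, Finset.sum_comm]
    have h2 : ∀ g : G, ∑ a, ρ.mat g a b * ρ.mat g⁻¹ c a = if b = c then 1 else 0 := by
      intro g
      have : (ρ.mat g⁻¹ * ρ.mat g) c b = if b = c then 1 else 0 := by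
        rw [← mat_mul, inv_mul_cancel, mat_one, Matrix.one_apply]
        simp [eq_comm]
      rw [← this, Matrix.mul_apply]
      exact Finset.sum_congr rfl fun a _ => mul_comm _ _
    simp only [h2]
    split_ifs <;> simp
  have hd : (d : ℂ) ≠ 0 := by exact_mod_cast hρ.pos_dim.ne'
  rw [key]
  by_cases haf : a = f <;> by_cases hbc : b = c <;> simp [haf, hbc] at htr ⊢
  · rw [eq_div_iff hd, mul_comm]; exact htr
  · rcases htr with h | h
    · exact absurd h hρ.pos_dim.ne'
    · exact h

/-- The sum of the squares of the degrees of inequivalent irreducible representations. -/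
theorem sum_dim_sq_le {ι : Type*} [Fintype ι] {d : ι → ℕ}
    {ρ : (i : ι) → Representation ℂ G (Fin (d i) → ℂ)} (hρ : ∀ i, (ρ i).IsIrreducible)
    (h : ∀ i j, i ≠ j → IsEmpty ((ρ i).Equiv (ρ j))) :
    ∑ i, d i ^ 2 ≤ Fintype.card G := by
  classical
  let v : (Σ i, Fin (d i) × Fin (d i)) → G → ℂ := fun p g => (ρ p.1).mat g p.2.1 p.2.2
  -- Pairing a relation with g ↦ ρ_j(g⁻¹)_{ba} isolates the coefficient at (j, a, b), up to the
  -- nonzero factor |G|/d_j. Independence inside ℂ^G then bounds the number of coefficients.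
  have hv : LinearIndependent ℂ v := by
    rw [Fintype.linearIndependent_iff]
    rintro c hc ⟨j, a, b⟩
    have h1 : ∑ g : G, (∑ p, c p • v p) g * (ρ j).mat g⁻¹ b a = 0 := by rw [hc]; simp
    have h2 : ∑ g : G, (∑ p, c p • v p) g * (ρ j).mat g⁻¹ b a =
        ∑ p : (Σ i, Fin (d i) × Fin (d i)), c p *
          ∑ g : G, (ρ p.1).mat g p.2.1 p.2.2 * (ρ j).mat g⁻¹ b a := by
      simp only [Finset.sum_apply, Finset.sum_mul, Finset.mul_sum]
      rw [Finset.sum_comm]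
      refine Finset.sum_congr rfl fun p _ => Finset.sum_congr rfl fun g _ => ?_
      simp [v, mul_assoc]
    rw [h2, Finset.sum_eq_single ⟨j, a, b⟩] at h1
    · rw [sum_mat_mul_mat_self (hρ j)] at h1
      have hd : (d j : ℂ) ≠ 0 := by exact_mod_cast (hρ j).pos_dim.ne'
      have hG : (Fintype.card G : ℂ) ≠ 0 := by exact_mod_cast Fintype.card_ne_zero
      simpa [hd, hG] using h1
    · rintro ⟨i, a', b'⟩ _ hne
      by_cases hij : i = j
      · subst hij
        rw [sum_mat_mul_mat_self (hρ i), if_neg, mul_zero]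
        rintro ⟨rfl, rfl⟩
        exact hne rfl
      · rw [sum_mat_mul_mat_of_isEmpty (hρ i) (hρ j) (h j i (Ne.symm hij)), mul_zero]
    · simp
  have := hv.fintype_card_le_finrank
  simpa [Fintype.card_sigma, sq] using this

end Orthogonality

end Representation

-- One representative is taken from each equivalence class. There are finitely many classes, since
-- |G| + 1 of them would each add at least 1 to a sum of squared degrees bounded by |G|.
open Representation in
theorem nonempty_irrepSystem (G : Type*) [Group G] [Finite G] : Nonempty (IrrepSystem G) := by
  classical
  have := Fintype.ofFinite G
  let T := Σ d : ℕ, {σ : Representation ℂ G (Fin d → ℂ) // σ.IsIrreducible}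
  let S : Setoid T :=
    { r := fun a b => Nonempty (a.2.1.Equiv b.2.1)
      iseqv := ⟨fun a => ⟨.refl _⟩, fun ⟨e⟩ => ⟨e.symm⟩, fun ⟨e⟩ ⟨f⟩ => ⟨e.trans f⟩⟩ }
  have hne : ∀ p q : Quotient S, p ≠ q → IsEmpty (p.out.2.1.Equiv q.out.2.1) := by
    intro p q hpq
    by_contra h
    rw [not_isEmpty_iff] at h
    apply hpq
    rw [← p.out_eq, ← q.out_eq]
    exact Quotient.sound h
  have hfin : Finite (Quotient S) := by
    by_contra hinf
    rw [not_finite_iff_infinite] at hinf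
    obtain ⟨s, hs⟩ := Infinite.exists_subset_card_eq (Quotient S) (Fintype.card G + 1)
    have h1 := sum_dim_sq_le (ι := s) (ρ := fun i => i.1.out.2.1) (fun i => i.1.out.2.2)
      (fun i j hij => hne _ _ fun h => hij (Subtype.ext h))
    have h2 : ∑ i : s, 1 ≤ ∑ i : s, i.1.out.1 ^ 2 :=
      Finset.sum_le_sum fun i _ => Nat.one_le_pow _ _ i.1.out.2.2.pos_dim
    rw [Finset.sum_const, Finset.card_univ, Fintype.card_coe, hs] at h2
    simp only [smul_eq_mul, mul_one] at h2
    omega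
  obtain ⟨n, ⟨e⟩⟩ := Finite.exists_equiv_fin (Quotient S)
  refine ⟨⟨n, fun i => (e.symm i).out.1, fun i => (e.symm i).out.2.1, fun i => (e.symm i).out.2.2,
    fun i j hij => hne _ _ (e.symm.injective.ne hij), fun d σ hσ => ?_⟩⟩
  refine ⟨e ⟦⟨d, σ, hσ⟩⟧, ?_⟩
  have : S.r (⟨d, σ, hσ⟩ : T) (Quotient.out (⟦⟨d, σ, hσ⟩⟧ : Quotient S)) :=
    Setoid.symm (Quotient.mk_out (s := S) (⟨d, σ, hσ⟩ : T))
  obtain ⟨f⟩ := this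
  rw [← e.symm_apply_apply ⟦⟨d, σ, hσ⟩⟧] at f
  exact ⟨f⟩

/-! ### Complete reducibility in coordinates -/

namespace IrrepSystem

open Representation
open scoped MonoidAlgebra

variable {G : Type*} [Group G]

theorem exists_equiv_rep (R : IrrepSystem G) {V : Type*} [AddCommGroup V] [Module ℂ V]
    [FiniteDimensional ℂ V] (ρ : Representation ℂ G V) (h : ρ.IsIrreducible) :
    ∃ i, Nonempty (ρ.Equiv (R.rep i)) := by
  let b := Module.finBasis ℂ V
  let e : V ≃ₗ[ℂ] (Fin (Module.finrank ℂ V) → ℂ) := b.equivFun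
  let σ : Representation ℂ G (Fin (Module.finrank ℂ V) → ℂ) :=
    (e.conjRingEquiv : Module.End ℂ V →* _).comp ρ
  have φ : ρ.Equiv σ := Representation.Equiv.mk e fun g => by
    ext v; simp [σ]
  obtain ⟨i, ⟨ψ⟩⟩ := R.complete _ σ (h.congr φ)
  exact ⟨i, ⟨φ.trans ψ⟩⟩

theorem sum_dim_sq_le (R : IrrepSystem G) [Fintype G] :
    ∑ i, R.dim i ^ 2 ≤ Fintype.card G :=
  Representation.sum_dim_sq_le R.irreducible R.inequivalent

/-- The simple quotient M receives its complex structure through ℂ → ℂ[G] only inside the proof.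
Hence `θ` is merely additive in the statement, and its linearity and equivariance are expressed
through vectors of V. -/
theorem exists_addEquiv_of_isSimpleModule [Finite G] (R : IrrepSystem G) {V : Type*}
    [AddCommGroup V] [Module ℂ V] [FiniteDimensional ℂ V] (ρ : Representation ℂ G V)
    {M : Type*} [AddCommGroup M] [Module ℂ[G] M] (hM : IsSimpleModule ℂ[G] M)
    (L : ρ.asModule →ₗ[ℂ[G]] M) (hL : Function.Surjective L) :
    ∃ (i : Fin R.num) (θ : M ≃+ (Fin (R.dim i) → ℂ)),
      (∀ (c : ℂ) v, θ (L (ρ.asModuleEquiv.symm (c • v))) = c • θ (L (ρ.asModuleEquiv.symm v))) ∧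
      ∀ g v, θ (L (ρ.asModuleEquiv.symm (ρ g v))) =
        R.rep i g (θ (L (ρ.asModuleEquiv.symm v))) := by
  let _ : Module ℂ M := Module.compHom M (algebraMap ℂ ℂ[G])
  have : IsScalarTower ℂ ℂ[G] M := ⟨fun c r x => by
    rw [Algebra.smul_def, mul_smul]; rfl⟩
  let σ : Representation ℂ G M := ofModule' M
  have hσ : ∀ g x, σ g x = MonoidAlgebra.of ℂ G g • x := fun g x => by simp [σ, ofModule']
  have hirr : σ.IsIrreducible := by
    rw [irreducible_iff_isSimpleModule_asModule]
    have hlift : σ.asAlgebraHom = Algebra.lsmul ℂ ℂ M :=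
      (MonoidAlgebra.lift ℂ _ G).apply_symm_apply _
    let E : σ.asModule ≃ₗ[ℂ[G]] M :=
      { σ.asModuleEquiv.toAddEquiv with
        map_smul' := fun r x => by
          change σ.asModuleEquiv (r • x) = r • σ.asModuleEquiv x
          rw [asModuleEquiv_map_smul, hlift, Algebra.lsmul_coe] }
    exact IsSimpleModule.congr E
  let u : V →ₗ[ℂ] M :=
    { toFun := fun v => L (ρ.asModuleEquiv.symm v)
      map_add' := fun v w => by simp
      map_smul' := fun c v => by
        rw [asModuleEquiv_symm_map_smul, map_smul]
        rfl }
  have hu : Function.Surjective u := by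
    intro y
    obtain ⟨x, hx⟩ := hL y
    exact ⟨ρ.asModuleEquiv x, by simp [u, hx]⟩
  have hfd : FiniteDimensional ℂ M := Module.Finite.of_surjective u hu
  obtain ⟨i, ⟨φ⟩⟩ := R.exists_equiv_rep _ hirr
  have hug : ∀ g v, u (ρ g v) = σ g (u v) := by
    intro g v
    simp only [u, LinearMap.coe_mk, AddHom.coe_mk]
    rw [asModuleEquiv_symm_map_rho, map_smul, hσ]
  refine ⟨i, φ.toLinearEquiv.toAddEquiv, ?_, ?_⟩
  · intro c v
    change φ.toLinearEquiv (u (c • v)) = c • φ.toLinearEquiv (u v)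
    rw [map_smul, map_smul]
  · intro g v
    change φ (u (ρ g v)) = R.rep i g (φ (u v))
    rw [hug]
    exact LinearMap.congr_fun (φ.toIntertwiningMap.isIntertwining' g) (u v)

/-- Complete reducibility, in coordinates. -/
theorem exists_decomposition [Finite G] (R : IrrepSystem G) {V : Type*} [AddCommGroup V]
    [Module ℂ V] [FiniteDimensional ℂ V] (ρ : Representation ℂ G V) :
    ∃ (m : ℕ) (f : Fin m → Fin R.num)
      (e : V ≃ₗ[ℂ] ((Σ i : Fin m, Fin (R.dim (f i))) → ℂ)),
      ∀ g v i p, e (ρ g v) ⟨i, p⟩ = R.rep (f i) g (fun q => e v ⟨i, q⟩) p := by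
  -- The hypothesis of Maschke's theorem.
  have : NeZero (Nat.card G : ℂ) := ⟨by exact_mod_cast Nat.card_pos.ne'⟩
  have hfin : Module.Finite ℂ[G] ρ.asModule := Module.Finite.of_restrictScalars_finite ℂ _ _
  obtain ⟨m, S, E, hS⟩ := IsSemisimpleModule.exists_linearEquiv_fin_dfinsupp ℂ[G] ρ.asModule
  have hL : ∀ i, Function.Surjective ((DFinsupp.lapply i : (Π₀ i, S i) →ₗ[ℂ[G]] S i) ∘ₗ
      E.toLinearMap) := by
    intro i y
    exact ⟨E.symm (DFinsupp.single i y), by simp⟩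
  choose f θ hθ hg using fun i => R.exists_addEquiv_of_isSimpleModule ρ (hS i) _ (hL i)
  let e₀ : V →ₗ[ℂ] ((Σ i : Fin m, Fin (R.dim (f i))) → ℂ) :=
    { toFun := fun v p => θ p.1 (E (ρ.asModuleEquiv.symm v) p.1) p.2
      map_add' := fun v w => by ext p; simp
      map_smul' := fun c v => by ext p; exact congrFun (hθ p.1 c v) p.2 }
  have he₀ : ∀ v i p, e₀ v ⟨i, p⟩ = θ i (E (ρ.asModuleEquiv.symm v) i) p := fun _ _ _ => rfl
  have hinj : Function.Injective e₀ := by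
    intro v w hvw
    have : E (ρ.asModuleEquiv.symm v) = E (ρ.asModuleEquiv.symm w) := by
      ext1 i
      apply (θ i).injective
      funext p
      exact congrFun hvw ⟨i, p⟩
    exact ρ.asModuleEquiv.symm.injective (E.injective this)
  have hsurj : Function.Surjective e₀ := by
    intro y
    refine ⟨ρ.asModuleEquiv (E.symm (DFinsupp.equivFunOnFintype.symm
      fun i => (θ i).symm fun p => y ⟨i, p⟩)), ?_⟩
    funext ⟨i, p⟩
    rw [he₀, LinearEquiv.symm_apply_apply, LinearEquiv.apply_symm_apply]
    exact congrFun ((θ i).apply_symm_apply _) p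
  refine ⟨m, f, LinearEquiv.ofBijective e₀ ⟨hinj, hsurj⟩, fun g v i p => ?_⟩
  exact congrFun (hg i g v) p

end IrrepSystem

/-! ### Reduction to a pair of subgroups -/

namespace IrrepSystem

open Representation

variable {G : Type*} [Group G]

/-- Index set of a basis adapted to the decomposition with multiplicities `n`. -/
abbrev AdaptedIndex (R : IrrepSystem G) (n : Fin R.num → ℕ) : Type :=
  Σ σ : Fin R.num, Fin (n σ) × Fin (R.dim σ)

theorem card_adaptedIndex (R : IrrepSystem G) (n : Fin R.num → ℕ) :
    Fintype.card (R.AdaptedIndex n) = ∑ σ, n σ * R.dim σ := by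
  simp [Fintype.card_sigma]

/-- The irreducible summands are grouped by isomorphism type; `n σ` is the multiplicity of σ. -/
theorem exists_adapted_equiv [Finite G] (R : IrrepSystem G) {V : Type*} [AddCommGroup V]
    [Module ℂ V] [FiniteDimensional ℂ V] (ρ : Representation ℂ G V) :
    ∃ (n : Fin R.num → ℕ) (e : V ≃ₗ[ℂ] (R.AdaptedIndex n → ℂ)),
      ∀ g v σ i p, e (ρ g v) ⟨σ, i, p⟩ = R.rep σ g (fun q => e v ⟨σ, i, q⟩) p := by
  classical
  obtain ⟨m, f, e, he⟩ := R.exists_decomposition ρ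
  let n : Fin R.num → ℕ := fun σ => Fintype.card {i // f i = σ}
  let ε : ∀ σ, Fin (n σ) ≃ {i // f i = σ} := fun σ => (Fintype.equivFin _).symm
  let E₁ : (Σ σ, {i // f i = σ} × Fin (R.dim σ)) ≃ Σ i : Fin m, Fin (R.dim (f i)) :=
    { toFun := fun x => ⟨x.2.1.1, Fin.cast (by rw [x.2.1.2]) x.2.2⟩
      invFun := fun x => ⟨f x.1, ⟨x.1, rfl⟩, x.2⟩
      left_inv := by rintro ⟨_, ⟨i, rfl⟩, p⟩; rfl
      right_inv := by rintro ⟨i, p⟩; rfl }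
  let E₂ : R.AdaptedIndex n ≃ Σ σ, {i // f i = σ} × Fin (R.dim σ) :=
    Equiv.sigmaCongrRight fun σ => (ε σ).prodCongr (Equiv.refl _)
  refine ⟨n, e.trans (LinearEquiv.funCongrLeft ℂ ℂ (E₂.trans E₁)), fun g v σ i p => ?_⟩
  have key : ∀ (σ : Fin R.num) (i : {i // f i = σ}) (p : Fin (R.dim σ)),
      e (ρ g v) (E₁ ⟨σ, i, p⟩) = R.rep σ g (fun q => e v (E₁ ⟨σ, i, q⟩)) p := by
    rintro _ ⟨i, rfl⟩ p
    exact he g v i p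
  exact key σ (ε σ i) p

/-- `P` holds the adapted basis and `P'` the adapted coordinates. The two intertwining identities
say P' ρ = Δ P' and ρ P = P Δ with Δ block diagonal: the former serves the left factor A, the latter
the right factor B. -/
theorem exists_adapted_matrix [Finite G] (R : IrrepSystem G) {d : ℕ}
    (ρ : Representation ℂ G (Fin d → ℂ)) :
    ∃ (n : Fin R.num → ℕ) (P : Matrix (Fin d) (R.AdaptedIndex n) ℂ)
      (P' : Matrix (R.AdaptedIndex n) (Fin d) ℂ),
      Fintype.card (R.AdaptedIndex n) = d ∧ P * P' = 1 ∧
      (∀ g σ i p u, (P' * ρ.mat g) ⟨σ, i, p⟩ u =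
        ∑ q, (R.rep σ).mat g p q * P' ⟨σ, i, q⟩ u) ∧
      (∀ g u σ i s, (ρ.mat g * P) u ⟨σ, i, s⟩ =
        ∑ r, P u ⟨σ, i, r⟩ * (R.rep σ).mat g r s) := by
  classical
  obtain ⟨n, e, he⟩ := R.exists_adapted_equiv ρ
  have hsum : ∀ (σ : Fin R.num) (g : G) (w : Fin (R.dim σ) → ℂ) p,
      R.rep σ g w p = ∑ q, (R.rep σ).mat g p q * w q := by
    intro σ g w p
    rw [← Matrix.toLin'_toMatrix' (R.rep σ g)]
    simp only [Matrix.toLin'_apply, Matrix.mulVec, dotProduct, mat]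
  have hP' : ∀ v x, (LinearMap.toMatrix' e.toLinearMap).mulVec v x = e v x := by
    intro v x
    rw [← Matrix.toLin'_apply, Matrix.toLin'_toMatrix']
    rfl
  refine ⟨n, LinearMap.toMatrix' e.symm.toLinearMap, LinearMap.toMatrix' e.toLinearMap, ?_, ?_,
    ?_, ?_⟩
  · have := e.finrank_eq
    simpa using this.symm
  · rw [← LinearMap.toMatrix'_comp]
    simp
  · intro g σ i p u
    rw [← LinearMap.toMatrix'_comp, LinearMap.toMatrix'_apply]
    simp only [LinearMap.comp_apply, LinearEquiv.coe_coe, he, hsum]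
    simp [LinearMap.toMatrix'_apply]
  · intro g u σ i s
    -- The image of a basis vector is compared in adapted coordinates; it stays inside its own copy
    -- (σ, i).
    have key : ρ g (e.symm (Pi.single ⟨σ, i, s⟩ 1)) =
        ∑ r, (R.rep σ).mat g r s • e.symm (Pi.single ⟨σ, i, r⟩ 1) := by
      apply e.injective
      funext ⟨τ, k, p⟩
      rw [he, hsum]
      simp only [LinearEquiv.apply_symm_apply, map_sum, map_smul, Finset.sum_apply, Pi.smul_apply,
        smul_eq_mul]
      by_cases h : (⟨σ, i⟩ : Σ σ, Fin (n σ)) = ⟨τ, k⟩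
      · cases h
        rw [Finset.sum_eq_single s, Finset.sum_eq_single p]
        · simp
        · intro r _ hr
          rw [Pi.single_apply, if_neg, mul_zero]
          intro h; cases h; exact hr rfl
        · simp
        · intro r _ hr
          rw [Pi.single_apply, if_neg, mul_zero]
          intro h; cases h; exact hr rfl
        · simp
      · rw [Finset.sum_eq_zero, Finset.sum_eq_zero]
        · intro r _
          rw [Pi.single_apply, if_neg, mul_zero]
          intro h'; cases h'; exact h rfl
        · intro r _
          rw [Pi.single_apply, if_neg, mul_zero]
          intro h'; cases h'; exact h rfl
    rw [← LinearMap.toMatrix'_comp, LinearMap.toMatrix'_apply]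
    have h2 := congrFun key u
    simp only [Finset.sum_apply, Pi.smul_apply, smul_eq_mul] at h2
    refine h2.trans (Finset.sum_congr rfl fun r _ => ?_)
    rw [mul_comm, LinearMap.toMatrix'_apply]
    rfl

theorem dft_apply [Fintype G] (R : IrrepSystem G) (c : G → ℂ)
    (o : Σ i : Fin R.num, Fin (R.dim i) × Fin (R.dim i)) :
    R.dft c o = ∑ g, c g * (R.rep o.1).mat g o.2.1 o.2.2 := by
  simp only [dft, Matrix.sum_apply, Matrix.smul_apply, smul_eq_mul]

theorem one_le_dim (R : IrrepSystem G) (i : Fin R.num) : 1 ≤ R.dim i :=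
  (R.irreducible i).pos_dim

theorem card_entries_le [Fintype G] (R : IrrepSystem G) :
    Fintype.card (Σ i : Fin R.num, Fin (R.dim i) × Fin (R.dim i)) ≤ Fintype.card G := by
  simpa [Fintype.card_sigma, sq] using R.sum_dim_sq_le

theorem dim_sq_le [Fintype G] (R : IrrepSystem G) (i : Fin R.num) :
    R.dim i ^ 2 ≤ Fintype.card G :=
  (Finset.single_le_sum (f := fun i => R.dim i ^ 2) (fun _ _ => Nat.zero_le _)
    (Finset.mem_univ i)).trans R.sum_dim_sq_le

end IrrepSystem

/-! ### Numerical estimates for matrix products -/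

/-- The exponent in excess of 2 is charged to M = |G|, leaving D², which can be summed over
irreducible representations. -/
theorem rpow_two_mul_le {D M : ℕ} {α : ℝ} (hα : 1 ≤ α) (hD : 1 ≤ D) (h : D ^ 2 ≤ M) :
    (D : ℝ) ^ (2 * α) ≤ (D : ℝ) ^ 2 * (M : ℝ) ^ (α - 1) := by
  have hD' : (0 : ℝ) < D := by exact_mod_cast hD
  have e : (D : ℝ) ^ (2 * α) = (D : ℝ) ^ 2 * ((D : ℝ) ^ 2) ^ (α - 1) := by
    rw [← Real.rpow_natCast (D : ℝ) 2, ← Real.rpow_mul hD'.le, ← Real.rpow_add hD']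
    congr 1; push_cast; ring
  rw [e]
  have h' : (D : ℝ) ^ 2 ≤ M := by exact_mod_cast h
  have := sub_nonneg.2 hα
  gcongr

theorem mul_rpow_sub_one {M : ℕ} {α : ℝ} (hM : 1 ≤ M) :
    (M : ℝ) * (M : ℝ) ^ (α - 1) = (M : ℝ) ^ α := by
  have hM' : (0 : ℝ) < M := by exact_mod_cast hM
  rw [Real.rpow_sub_one hM'.ne', mul_div_cancel₀ _ hM'.ne']

/-- The cost of multiplying a square matrix of size `D` by a `D × N` matrix. -/
theorem rectangular_cost_le {D N M : ℕ} {α C : ℝ} (hα : 1 ≤ α) (hC : 0 ≤ C) (hD : 1 ≤ D)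
    (h : D ^ 2 ≤ M) :
    ((N : ℝ) / D + 1) * (C * (D : ℝ) ^ (2 * α)) ≤
      C * ((N : ℝ) * D + (D : ℝ) ^ 2) * (M : ℝ) ^ (α - 1) := by
  have hD' : (0 : ℝ) < D := by exact_mod_cast hD
  calc ((N : ℝ) / D + 1) * (C * (D : ℝ) ^ (2 * α))
      ≤ ((N : ℝ) / D + 1) * (C * ((D : ℝ) ^ 2 * (M : ℝ) ^ (α - 1))) := by
        gcongr; exact rpow_two_mul_le hα hD h
    _ = _ := by field_simp

section Reduction

open Representation

variable {G A B X : Type*} [Group G] [Fintype G] [Group A] [Fintype A] [Group B] [Fintype B]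

/-- The generalized DFT of a function supported on `x * φ A * ψ B`. -/
theorem cost_dft_product {C α TA TB : ℝ} (hC : 0 ≤ C) (hα : 1 ≤ α) (hM : MatMulRate C (2 * α))
    (RA : IrrepSystem A) (RB : IrrepSystem B) (R : IrrepSystem G)
    (hA : ComputableWithin RA.dft TA) (hB : ComputableWithin RB.dft TB)
    (φ : A →* G) (ψ : B →* G) (hφψ : Function.Injective fun p : A × B => φ p.1 * ψ p.2) (x : G)
    {S : Set (X → ℂ)} (c : A → B → X → ℂ) (hc : ∀ a b, c a b ∈ S ∪ constFuns X ℂ) :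
    Cost S (Fintype.card B * TA + Fintype.card A * TB + 6 * C * (Fintype.card G : ℝ) ^ α)
      (Set.range fun (o : Σ i : Fin R.num, Fin (R.dim i) × Fin (R.dim i)) y =>
        ∑ a, ∑ b, c a b y * (R.rep o.1).mat (x * φ a * ψ b) o.2.1 o.2.2) := by
  classical
  have hAB : Fintype.card A * Fintype.card B ≤ Fintype.card G := by
    simpa using Fintype.card_le_of_injective _ hφψ
  have hG1 : 1 ≤ Fintype.card G := Fintype.card_pos
  choose nA P P' hcardA hPP hP' _hP using fun i : Fin R.num =>
    RA.exists_adapted_matrix ((R.rep i).comp φ)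
  choose nB Q Q' hcardB hQQ _hQ hQ' using fun i : Fin R.num =>
    RB.exists_adapted_matrix ((R.rep i).comp ψ)
  let IA := Σ i : Fin RA.num, Fin (RA.dim i) × Fin (RA.dim i)
  let IB := Σ i : Fin RB.num, Fin (RB.dim i) × Fin (RB.dim i)
  let d1 : IA → B → X → ℂ := fun o b y => RA.dft (fun a => c a b y) o
  let d2 : IA → IB → X → ℂ := fun o o' y => RB.dft (fun b => d1 o b y) o'
  have cost1 : Cost S (Fintype.card B * TA) (⋃ b, Set.range fun o => d1 o b) := by
    have := Cost.iUnion (J := B) fun b => Cost.of_computableWithin hA (u := fun a => c a b)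
      (fun a => hc a b)
    simpa using this
  have hTB : 0 ≤ TB := by
    obtain ⟨m, _, _, hm, _⟩ := hB
    exact le_trans (Nat.cast_nonneg _) hm
  have cost2 : Cost S (Fintype.card B * TA + Fintype.card A * TB)
      (⋃ o : IA, Set.range fun o' => d2 o o') := by
    -- One DFT over B for each matrix coefficient of A, of which there are at most |A|.
    have h := Cost.iUnion (J := IA) (B := ⋃ b, Set.range fun o => d1 o b) fun o =>
      Cost.of_computableWithin hB (u := fun b => d1 o b)
      (fun b => Or.inl (Set.mem_iUnion.2 ⟨b, o, rfl⟩))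
    refine cost1.trans (h.mono_time ?_)
    rw [Finset.sum_const, nsmul_eq_mul, Finset.card_univ]
    gcongr
    exact RA.card_entries_le
  -- The change of basis between the A-adapted and the B-adapted coordinates of ρ_i; it does not
  -- depend on the input.
  let M : ∀ i : Fin R.num, Matrix (RA.AdaptedIndex (nA i)) (RB.AdaptedIndex (nB i)) ℂ :=
    fun i => P' i * Q i
  let Z : ∀ i : Fin R.num, RA.AdaptedIndex (nA i) → RB.AdaptedIndex (nB i) → X → ℂ :=
    fun i u v y => ∑ w : Fin (RA.dim u.1) × Fin (RB.dim v.1),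
      d2 ⟨u.1, u.2.2, w.1⟩ ⟨v.1, w.2, v.2.2⟩ y * M i ⟨u.1, u.2.1, w.1⟩ ⟨v.1, v.2.1, w.2⟩
  have cost3 : Cost (⋃ o : IA, Set.range fun o' => d2 o o')
      (2 * C * (Fintype.card G : ℝ) ^ α) (⋃ i, ⋃ u, Set.range (Z i u)) := by
    -- For fixed (σ, τ), the pairs (copy of σ, copy of τ) in all irreducibles of G together index
    -- the columns of a single product.
    let μ : Fin RA.num × Fin RB.num → Type := fun st =>
      Σ i : Fin R.num, Fin (nA i st.1) × Fin (nB i st.2)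
    have h := Cost.iUnion (J := Fin RA.num × Fin RB.num)
      (B := ⋃ o : IA, Set.range fun o' => d2 o o') fun st =>
      Cost.mulEntries (ι := Fin (RA.dim st.1) × Fin (RB.dim st.2))
        (κ := Fin (RA.dim st.1) × Fin (RB.dim st.2)) (μ := μ st) hC hM rfl
        (a := fun ps w => d2 ⟨st.1, ps.1, w.1⟩ ⟨st.2, w.2, ps.2⟩)
        (b := fun w t _ => M t.1 ⟨st.1, t.2.1, w.1⟩ ⟨st.2, t.2.2, w.2⟩)
        (fun ps w => Or.inl (Set.mem_iUnion.2 ⟨_, _, rfl⟩))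
        (fun w t => Or.inr (const_mem_constFuns _))
    refine h.mono ?_ ?_
    · have hle : ∀ st : Fin RA.num × Fin RB.num,
          ((Fintype.card (μ st) : ℝ) / Fintype.card (Fin (RA.dim st.1) × Fin (RB.dim st.2)) + 1) *
            (C * (Fintype.card (Fin (RA.dim st.1) × Fin (RB.dim st.2)) : ℝ) ^ (2 * α)) ≤
          C * (((∑ i, nA i st.1 * nB i st.2) * (RA.dim st.1 * RB.dim st.2) +
            RA.dim st.1 ^ 2 * RB.dim st.2 ^ 2 : ℕ) : ℝ) * (Fintype.card G : ℝ) ^ (α - 1) := by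
        intro st
        have e1 : Fintype.card (Fin (RA.dim st.1) × Fin (RB.dim st.2)) =
          RA.dim st.1 * RB.dim st.2 := by simp
        have e2 : Fintype.card (μ st) = ∑ i, nA i st.1 * nB i st.2 := by
          simp [μ, Fintype.card_sigma]
        rw [e1, e2]
        refine (rectangular_cost_le hα hC ?_ (M := Fintype.card G) ?_).trans (le_of_eq ?_)
        · exact Nat.mul_pos (RA.one_le_dim _) (RB.one_le_dim _)
        · rw [mul_pow]
          exact (Nat.mul_le_mul (RA.dim_sq_le _) (RB.dim_sq_le _)).trans hAB
        · push_cast; ring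
      refine (Finset.sum_le_sum fun st _ => hle st).trans ?_
      rw [← Finset.sum_mul, ← Finset.mul_sum, ← Nat.cast_sum]
      -- The first part sums to Σ_i (Σ_σ n_σ d_σ)(Σ_τ n_τ d_τ) = Σ_i (dim ρ_i)² ≤ |G|, the second to
      -- (Σ d_σ²)(Σ d_τ²) ≤ |A||B| ≤ |G|.
      have hcount : ∑ st : Fin RA.num × Fin RB.num,
          ((∑ i, nA i st.1 * nB i st.2) * (RA.dim st.1 * RB.dim st.2) +
            RA.dim st.1 ^ 2 * RB.dim st.2 ^ 2) ≤ 2 * Fintype.card G := by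
        rw [Finset.sum_add_distrib, two_mul]
        refine add_le_add ?_ ?_
        · refine le_trans (le_of_eq ?_) R.sum_dim_sq_le
          simp only [Finset.sum_mul]
          rw [Finset.sum_comm]
          refine Finset.sum_congr rfl fun i _ => ?_
          have e1 := (RA.card_adaptedIndex (nA i)).symm.trans (hcardA i)
          have e2 := (RB.card_adaptedIndex (nB i)).symm.trans (hcardB i)
          rw [sq]
          nth_rw 1 [← e1]
          rw [← e2, Finset.sum_mul_sum, Fintype.sum_prod_type]
          refine Finset.sum_congr rfl fun s _ => Finset.sum_congr rfl fun t _ => ?_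
          ring
        · rw [Fintype.sum_prod_type]
          simp only
          rw [← Finset.sum_mul_sum]
          exact (Nat.mul_le_mul RA.sum_dim_sq_le RB.sum_dim_sq_le).trans hAB
      calc _ ≤ C * ((2 * Fintype.card G : ℕ) : ℝ) * (Fintype.card G : ℝ) ^ (α - 1) := by
            gcongr
        _ = 2 * C * (Fintype.card G * (Fintype.card G : ℝ) ^ (α - 1)) := by push_cast; ring
        _ = _ := by rw [mul_rpow_sub_one hG1]
    · intro f hf
      obtain ⟨i, hf⟩ := Set.mem_iUnion.1 hf
      obtain ⟨⟨σ, m, p⟩, hf⟩ := Set.mem_iUnion.1 hf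
      obtain ⟨⟨τ, k, s⟩, rfl⟩ := hf
      exact Set.mem_iUnion.2 ⟨(σ, τ), ⟨((p, s), ⟨i, m, k⟩), rfl⟩⟩
  -- The translation by x is merged into the base change on the left, so it costs nothing extra.
  let L : ∀ i : Fin R.num, Matrix (Fin (R.dim i)) (RA.AdaptedIndex (nA i)) ℂ :=
    fun i => (R.rep i).mat x * P i
  let W1 : ∀ i : Fin R.num, Fin (R.dim i) → RB.AdaptedIndex (nB i) → X → ℂ :=
    fun i u v y => ∑ w, L i u w * Z i w v y
  let W : ∀ i : Fin R.num, Fin (R.dim i) → Fin (R.dim i) → X → ℂ :=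
    fun i u v y => ∑ w, W1 i u w y * Q' i w v
  have hsq : ∀ (N : ℕ → ℝ), (∀ D, 1 ≤ D → N D = 1) →
      ∑ i, (N (R.dim i) + 1) * (C * (R.dim i : ℝ) ^ (2 * α)) ≤
        2 * C * (Fintype.card G : ℝ) ^ α := by
    intro N hN
    have h1 : ∀ i, (N (R.dim i) + 1) * (C * (R.dim i : ℝ) ^ (2 * α)) ≤
        2 * C * (((R.dim i ^ 2 : ℕ) : ℝ) * (Fintype.card G : ℝ) ^ (α - 1)) := by
      intro i
      rw [hN _ (R.one_le_dim i)]
      have := rpow_two_mul_le hα (R.one_le_dim i) (R.dim_sq_le i)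
      push_cast
      nlinarith
    refine (Finset.sum_le_sum fun i _ => h1 i).trans ?_
    rw [← Finset.mul_sum, ← Finset.sum_mul, ← Nat.cast_sum,
      ← mul_rpow_sub_one (α := α) hG1]
    have := R.sum_dim_sq_le
    gcongr
  have hone : ∀ D : ℕ, 1 ≤ D → (D : ℝ) / D = 1 := fun D hD =>
    div_self (by exact_mod_cast (Nat.one_le_iff_ne_zero.1 hD))
  have cost4 : Cost (⋃ i, ⋃ u, Set.range (Z i u)) (2 * C * (Fintype.card G : ℝ) ^ α)
      (⋃ i, ⋃ u, Set.range (W1 i u)) := by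
    have h := Cost.iUnion (J := Fin R.num) (B := ⋃ i, ⋃ u, Set.range (Z i u)) fun i =>
      Cost.mulEntries (ι := Fin (R.dim i)) (κ := RA.AdaptedIndex (nA i))
        (μ := RB.AdaptedIndex (nB i)) hC hM (by rw [hcardA, Fintype.card_fin])
        (a := fun u w _ => L i u w) (b := Z i)
        (fun u w => Or.inr (const_mem_constFuns _))
        (fun w t => Or.inl (Set.mem_iUnion.2 ⟨i, Set.mem_iUnion.2 ⟨w, t, rfl⟩⟩))
    refine h.mono ?_ ?_
    · simp only [hcardB, Fintype.card_fin]
      exact hsq (fun D => (D : ℝ) / D) hone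
    · intro f hf
      obtain ⟨i, hf⟩ := Set.mem_iUnion.1 hf
      obtain ⟨u, v, rfl⟩ := Set.mem_iUnion.1 hf
      exact Set.mem_iUnion.2 ⟨i, (u, v), rfl⟩
  have cost5 : Cost (⋃ i, ⋃ u, Set.range (W1 i u)) (2 * C * (Fintype.card G : ℝ) ^ α)
      (⋃ i, ⋃ u, Set.range (W i u)) := by
    have h := Cost.iUnion (J := Fin R.num) (B := ⋃ i, ⋃ u, Set.range (W1 i u)) fun i =>
      Cost.mulEntries (ι := Fin (R.dim i)) (κ := RB.AdaptedIndex (nB i))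
        (μ := Fin (R.dim i)) hC hM (by rw [hcardB, Fintype.card_fin])
        (a := W1 i) (b := fun w v _ => Q' i w v)
        (fun w t => Or.inl (Set.mem_iUnion.2 ⟨i, Set.mem_iUnion.2 ⟨w, t, rfl⟩⟩))
        (fun u w => Or.inr (const_mem_constFuns _))
    refine h.mono ?_ ?_
    · simp only [Fintype.card_fin]
      exact hsq (fun D => (D : ℝ) / D) hone
    · intro f hf
      obtain ⟨i, hf⟩ := Set.mem_iUnion.1 hf
      obtain ⟨u, v, rfl⟩ := Set.mem_iUnion.1 hf
      exact Set.mem_iUnion.2 ⟨i, (u, v), rfl⟩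
  -- Z is P' (Σ c(a,b) ρ(φ(a)) ρ(ψ(b))) Q: moving ρ(φ(a)) through P' and ρ(ψ(b)) through Q leaves
  -- σ(a) M τ(b) in each block.
  have hZ : ∀ i u v y, Z i u v y = ∑ a, ∑ b, c a b y *
      ((P' i * (R.rep i).mat (φ a)) * ((R.rep i).mat (ψ b) * Q i)) u v := by
    rintro i ⟨σ, m, p⟩ ⟨τ, k, s⟩ y
    have e : ∀ a b, ((P' i * (R.rep i).mat (φ a)) * ((R.rep i).mat (ψ b) * Q i))
        ⟨σ, m, p⟩ ⟨τ, k, s⟩ = ∑ w : Fin (RA.dim σ) × Fin (RB.dim τ),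
          (RA.rep σ).mat a p w.1 * (RB.rep τ).mat b w.2 s * M i ⟨σ, m, w.1⟩ ⟨τ, k, w.2⟩ := by
      intro a b
      rw [Fintype.sum_prod_type, Matrix.mul_apply]
      have h1 := hP' i a σ m p
      have h2 := fun u => hQ' i b u τ k s
      change ∀ u, (P' i * (R.rep i).mat (φ a)) ⟨σ, m, p⟩ u = _ at h1
      change ∀ u, ((R.rep i).mat (ψ b) * Q i) u ⟨τ, k, s⟩ = _ at h2
      simp only [h1, h2, Finset.sum_mul_sum]
      rw [Finset.sum_comm]
      refine Finset.sum_congr rfl fun q _ => ?_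
      rw [Finset.sum_comm]
      refine Finset.sum_congr rfl fun r _ => ?_
      simp only [M, Matrix.mul_apply, Finset.mul_sum]
      refine Finset.sum_congr rfl fun u _ => ?_
      ring
    simp only [e, Z, d2, d1, IrrepSystem.dft_apply, Finset.mul_sum, Finset.sum_mul]
    rw [Finset.sum_congr rfl fun w _ => Finset.sum_comm, Finset.sum_comm]
    refine Finset.sum_congr rfl fun a _ => ?_
    rw [Finset.sum_comm]
    refine Finset.sum_congr rfl fun b _ => Finset.sum_congr rfl fun w _ => ?_
    ring
  refine (((cost2.trans cost3).trans cost4).trans cost5).mono (by ring_nf; rfl) ?_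
  rintro _ ⟨⟨i, u, v⟩, rfl⟩
  refine Set.mem_iUnion.2 ⟨i, Set.mem_iUnion.2 ⟨u, v, ?_⟩⟩
  funext y
  have e1 : ∀ a b, (R.rep i).mat (x * φ a * ψ b) =
      L i * ((P' i * (R.rep i).mat (φ a)) * ((R.rep i).mat (ψ b) * Q i)) * Q' i := by
    intro a b
    rw [mat_mul, mat_mul]
    calc _ = (R.rep i).mat x * (P i * P' i) * (R.rep i).mat (φ a) * (R.rep i).mat (ψ b) *
          (Q i * Q' i) := by rw [hPP, hQQ, mul_one, mul_one]
      _ = _ := by simp only [L, Matrix.mul_assoc]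
  have e2 : W i u v y = (L i * (Matrix.of fun u v => Z i u v y) * Q' i) u v := by
    simp [W, W1, Matrix.mul_apply]
  have e3 : (Matrix.of fun u v => Z i u v y) = ∑ a, ∑ b, c a b y •
      ((P' i * (R.rep i).mat (φ a)) * ((R.rep i).mat (ψ b) * Q i)) := by
    ext u v
    simp only [Matrix.of_apply, hZ, Matrix.sum_apply, Matrix.smul_apply, smul_eq_mul]
  rw [e2, e3]
  simp only [e1, Matrix.mul_sum, Matrix.sum_mul, Matrix.sum_apply, Matrix.mul_smul,
    Matrix.smul_mul, Matrix.smul_apply, smul_eq_mul]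

end Reduction

/-! ### Covers by translates, and rates -/

section Reduction

open Representation

variable {G A B : Type*} [Group G] [Fintype G] [Group A] [Fintype A] [Group B] [Fintype B]

/-- Translates may overlap, so each g is assigned to one chosen translate containing it; on the
other translates its coefficient is zero. -/
theorem exists_translate_coefficients {J : Type*} [Fintype J] (φ : A →* G) (ψ : B →* G)
    (hφψ : Function.Injective fun p : A × B => φ p.1 * ψ p.2) (x : J → G)
    (hx : ∀ g, ∃ j a b, g = x j * φ a * ψ b) :
    ∃ c : J → A → B → (G → ℂ) → ℂ,
      (∀ j a b, c j a b ∈ coordFuns G ℂ ∪ constFuns (G → ℂ) ℂ) ∧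
      ∀ (w : G → ℂ) (y : G → ℂ),
        ∑ g, y g * w g = ∑ j, ∑ a, ∑ b, c j a b y * w (x j * φ a * ψ b) := by
  classical
  choose sel hsel using hx
  refine ⟨fun j a b y => if sel (x j * φ a * ψ b) = j then y (x j * φ a * ψ b) else 0,
    fun j a b => ?_, fun w y => ?_⟩
  · by_cases h : sel (x j * φ a * ψ b) = j
    · simp only [h, if_true]; exact Or.inl ⟨_, rfl⟩
    · simp only [h, if_false]; exact Or.inr (const_mem_constFuns 0)
  · have key : ∀ j, ∑ a, ∑ b, (if sel (x j * φ a * ψ b) = j then y (x j * φ a * ψ b) else 0) *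
        w (x j * φ a * ψ b) = ∑ g, if sel g = j then y g * w g else 0 := by
      intro j
      rw [← Fintype.sum_prod_type']
      refine Fintype.sum_of_injective (fun p : A × B => x j * φ p.1 * ψ p.2) ?_ _ _ ?_ ?_
      · intro p q hpq
        apply hφψ
        simpa [mul_assoc] using hpq
      · intro g hg
        rw [if_neg]
        rintro rfl
        obtain ⟨a, b, hab⟩ := hsel g
        exact hg ⟨(a, b), hab.symm⟩
      · intro p
        rw [ite_mul, zero_mul]
    simp only [key]
    rw [Finset.sum_comm]
    simp

/-- The reduction of the generalized DFT of `G`, covered by translates of `φ A * ψ B`, to those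
of `A` and `B`. -/
theorem HasGeneralizedDFT.of_cover {C α TA TB : ℝ} (hC : 1 ≤ C) (hα : 1 ≤ α)
    (hM : MatMulRate C (2 * α)) {J : Type*} [Fintype J]
    (hA : HasGeneralizedDFT A TA) (hB : HasGeneralizedDFT B TB)
    (φ : A →* G) (ψ : B →* G) (hφψ : Function.Injective fun p : A × B => φ p.1 * ψ p.2)
    (x : J → G) (hx : ∀ g, ∃ j a b, g = x j * φ a * ψ b) :
    HasGeneralizedDFT G (Fintype.card J * (Fintype.card B * TA + Fintype.card A * TB +
      7 * C * (Fintype.card G : ℝ) ^ α)) := by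
  refine ⟨nonempty_irrepSystem G, fun R => ?_⟩
  obtain ⟨⟨RA⟩, hA⟩ := hA
  obtain ⟨⟨RB⟩, hB⟩ := hB
  obtain ⟨c, hc, hsum⟩ := exists_translate_coefficients φ ψ hφψ x hx
  rw [computableWithin_iff_cost]
  let O := Σ i : Fin R.num, Fin (R.dim i) × Fin (R.dim i)
  let v : J → O → (G → ℂ) → ℂ := fun j o y =>
    ∑ a, ∑ b, c j a b y * (R.rep o.1).mat (x j * φ a * ψ b) o.2.1 o.2.2
  have h1 := Cost.iUnion (J := J) fun j => cost_dft_product (by linarith) hα hM RA RB R (hA RA)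
    (hB RB) φ ψ hφψ (x j) (c j) (hc j)
  have h2 : Cost (⋃ j, Set.range (v j)) (Fintype.card O * Fintype.card J)
      (Set.range fun o y => R.dft y o) := by
    refine Cost.range_of_forall fun o => ?_
    have e : (fun y => R.dft y o) = fun y => ∑ j, v j o y := by
      funext y
      rw [IrrepSystem.dft_apply, hsum]
    rw [e]
    exact Cost.sum Finset.univ fun j _ => Or.inl (Set.mem_iUnion.2 ⟨j, o, rfl⟩)
  refine (h1.trans h2).mono_time ?_
  rw [Finset.sum_const, nsmul_eq_mul, Finset.card_univ, mul_comm (Fintype.card O : ℝ), ← mul_add]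
  -- Adding up the contributions of the translates accounts for the seventh C.
  have h3 : (Fintype.card O : ℝ) ≤ C * (Fintype.card G : ℝ) ^ α := by
    have hG : (1 : ℝ) ≤ Fintype.card G := by exact_mod_cast Fintype.card_pos
    calc (Fintype.card O : ℝ) ≤ Fintype.card G := by exact_mod_cast R.card_entries_le
      _ = (Fintype.card G : ℝ) ^ (1 : ℝ) := (Real.rpow_one _).symm
      _ ≤ (Fintype.card G : ℝ) ^ α := Real.rpow_le_rpow_of_exponent_le hG hα
      _ ≤ _ := le_mul_of_one_le_left (by positivity) hC
  have : (0 : ℝ) ≤ Fintype.card J := Nat.cast_nonneg _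
  exact mul_le_mul_of_nonneg_left (by linarith) this

theorem card_le_rpow {α : ℝ} (hα : 1 ≤ α) (G : Type*) [Group G] [Fintype G] :
    (Fintype.card G : ℝ) ≤ (Fintype.card G : ℝ) ^ α := by
  have hG : (1 : ℝ) ≤ Fintype.card G := by exact_mod_cast Fintype.card_pos
  simpa using Real.rpow_le_rpow_of_exponent_le hG hα

/-- `G` has a generalized DFT using at most `t * |G| ^ α` operations. -/
def DFTRate (α : ℝ) (G : Type*) [Group G] [Fintype G] (t : ℝ) : Prop :=
  HasGeneralizedDFT G (t * (Fintype.card G : ℝ) ^ α)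

theorem DFTRate.mono {α s t : ℝ} (h : DFTRate α G s) (hst : s ≤ t) : DFTRate α G t := by
  refine ⟨h.1, fun R => ?_⟩
  obtain ⟨m, P, out, hm, hP⟩ := h.2 R
  exact ⟨m, P, out, hm.trans (by gcongr), hP⟩

theorem DFTRate.nonneg {α t : ℝ} (h : DFTRate α G t) : 0 ≤ t := by
  obtain ⟨⟨R⟩, h⟩ := h
  obtain ⟨m, _, _, hm, _⟩ := h R
  have hG : (0 : ℝ) < Fintype.card G := by exact_mod_cast Fintype.card_pos
  exact nonneg_of_mul_nonneg_left (le_trans (Nat.cast_nonneg m) hm) (Real.rpow_pos_of_pos hG α)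

/-- Since |B| · s|A|^α ≤ s(|A||B|)^α ≤ s|G|^α, and symmetrically for B, the rates of A and B add
instead of multiplying. -/
theorem DFTRate.of_cover {C α s t : ℝ} (hC : 1 ≤ C) (hα : 1 ≤ α)
    (hM : MatMulRate C (2 * α)) {J : Type*} [Fintype J]
    (hA : DFTRate α A s) (hB : DFTRate α B t)
    (φ : A →* G) (ψ : B →* G) (hφψ : Function.Injective fun p : A × B => φ p.1 * ψ p.2)
    (x : J → G) (hx : ∀ g, ∃ j a b, g = x j * φ a * ψ b) :
    DFTRate α G (Fintype.card J * (s + t + 7 * C)) := by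
  have hs := hA.nonneg
  have ht := hB.nonneg
  have h := HasGeneralizedDFT.of_cover hC hα hM hA hB φ ψ hφψ x hx
  have hAB : (Fintype.card A : ℝ) * Fintype.card B ≤ Fintype.card G := by
    have := Fintype.card_le_of_injective _ hφψ
    rw [Fintype.card_prod] at this
    exact_mod_cast this
  have key : (Fintype.card A : ℝ) ^ α * (Fintype.card B : ℝ) ^ α ≤ (Fintype.card G : ℝ) ^ α := by
    rw [← Real.mul_rpow (by positivity) (by positivity)]
    gcongr
  refine ⟨h.1, fun R => ?_⟩
  obtain ⟨m, P, out, hm, hP⟩ := h.2 R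
  refine ⟨m, P, out, hm.trans ?_, hP⟩
  rw [mul_assoc (Fintype.card J : ℝ)]
  refine mul_le_mul_of_nonneg_left ?_ (Nat.cast_nonneg (α := ℝ) _)
  have h1 : (Fintype.card B : ℝ) * (s * (Fintype.card A : ℝ) ^ α) ≤
      s * (Fintype.card G : ℝ) ^ α := by
    calc _ = s * ((Fintype.card A : ℝ) ^ α * Fintype.card B) := by ring
      _ ≤ s * ((Fintype.card A : ℝ) ^ α * (Fintype.card B : ℝ) ^ α) := by
        gcongr; exact card_le_rpow hα B
      _ ≤ _ := by gcongr
  have h2 : (Fintype.card A : ℝ) * (t * (Fintype.card B : ℝ) ^ α) ≤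
      t * (Fintype.card G : ℝ) ^ α := by
    calc _ = t * (Fintype.card A * (Fintype.card B : ℝ) ^ α) := by ring
      _ ≤ t * ((Fintype.card A : ℝ) ^ α * (Fintype.card B : ℝ) ^ α) := by
        gcongr; exact card_le_rpow hα A
      _ ≤ _ := by gcongr
  linarith

theorem DFTRate.of_factorization {C α s t : ℝ} (hC : 1 ≤ C) (hα : 1 ≤ α)
    (hM : MatMulRate C (2 * α)) (hA : DFTRate α A s) (hB : DFTRate α B t)
    (φ : A →* G) (ψ : B →* G) (hφψ : Function.Bijective fun p : A × B => φ p.1 * ψ p.2) :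
    DFTRate α G (s + t + 7 * C) := by
  have := DFTRate.of_cover hC hα hM hA hB φ ψ hφψ.1 (fun _ : Unit => 1) fun g => by
    obtain ⟨⟨a, b⟩, h⟩ := hφψ.2 g
    exact ⟨(), a, b, by simpa using h.symm⟩
  simpa using this

end Reduction

/-! ### Discrete Fourier transforms of cyclic groups -/

section FFT

variable {X : Type*} {B : Set (X → ℂ)}

theorem Finset.sum_range_two_mul {M : Type*} [AddCommMonoid M] (f : ℕ → M) (n : ℕ) :
    ∑ t ∈ Finset.range (2 * n), f t =
      ∑ s ∈ Finset.range n, f (2 * s) + ∑ s ∈ Finset.range n, f (2 * s + 1) := by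
  induction n with
  | zero => simp
  | succ n ih =>
    rw [Nat.mul_succ, Finset.sum_range_succ, Finset.sum_range_succ, ih, Finset.sum_range_succ,
      Finset.sum_range_succ]
    abel

/-- The fast Fourier transform. -/
theorem Cost.fft (r : ℕ) {η : ℂ} (hη : η ^ 2 ^ r = 1) {u : ℕ → X → ℂ}
    (hu : ∀ t, u t ∈ B ∪ constFuns X ℂ) :
    Cost B (2 * r * 2 ^ r)
      (Set.range fun (k : ℕ) y => ∑ t ∈ Finset.range (2 ^ r), u t y * η ^ (t * k)) := by
  induction r generalizing η u with
  | zero =>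
    simp only [pow_zero, Finset.sum_range_one, zero_mul, mul_one, CharP.cast_eq_zero, mul_zero]
    refine Cost.of_subset ?_
    rintro _ ⟨k, rfl⟩
    exact hu 0
  | succ r ih =>
    -- Split into even and odd indices, each a transform with η². Recombining takes one
    -- multiplication and one addition per output.
    have hη2 : (η ^ 2) ^ 2 ^ r = 1 := by rw [← pow_mul, ← pow_succ', hη]
    have h1 := (ih hη2 (u := fun s => u (2 * s)) fun s => hu _).union
      (ih hη2 (u := fun s => u (2 * s + 1)) fun s => hu _)
    set F := fun (u : ℕ → X → ℂ) (k : ℕ) (y : X) =>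
      ∑ t ∈ Finset.range (2 ^ r), u t y * (η ^ 2) ^ (t * k) with hF
    have h2 : ∀ k : Fin (2 ^ (r + 1)), Cost (Set.range (F fun s => u (2 * s)) ∪
        Set.range (F fun s => u (2 * s + 1))) 2
        {fun y => F (fun s => u (2 * s)) k y + η ^ (k : ℕ) * F (fun s => u (2 * s + 1)) k y} := by
      intro k
      have h3 := (Cost.mul (B := Set.range (F fun s => u (2 * s)) ∪
        Set.range (F fun s => u (2 * s + 1))) (Or.inr (const_mem_constFuns (η ^ (k : ℕ))))
        (Or.inl (Or.inr ⟨k, rfl⟩))).with_base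
      have h4 := h3.trans (Cost.add (a := F (fun s => u (2 * s)) k)
        (Or.inl (Or.inl (Or.inl ⟨k, rfl⟩))) (Or.inl (Or.inr rfl)))
      exact h4.mono_time (by norm_num)
    refine (h1.trans (Cost.range_of_forall h2)).mono ?_ ?_
    · rw [Fintype.card_fin]; push_cast; ring_nf; rfl
    · rintro _ ⟨k, rfl⟩
      refine ⟨⟨k % 2 ^ (r + 1), Nat.mod_lt _ (by positivity)⟩, funext fun y => ?_⟩
      -- Outputs are periodic in k modulo 2^(r+1), so finitely many computed values serve all
      -- natural k.
      have hper : ∀ t, η ^ (t * k) = η ^ (t * (k % 2 ^ (r + 1))) := by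
        intro t
        rw [mul_comm, pow_mul, mul_comm t, pow_mul]
        congr 1
        conv_lhs => rw [← Nat.mod_add_div k (2 ^ (r + 1)), pow_add, pow_mul, hη, one_pow, mul_one]
      simp only [hper]
      generalize k % 2 ^ (r + 1) = k
      rw [pow_succ', Finset.sum_range_two_mul, hF]
      simp only [Finset.mul_sum]
      congr 1
      · refine Finset.sum_congr rfl fun s _ => ?_
        rw [← pow_mul]; ring_nf
      · refine Finset.sum_congr rfl fun s _ => ?_
        rw [← pow_mul]; ring_nf

/-- The Vandermonde matrix of the M distinct powers of η is invertible. -/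
theorem exists_fourier_coefficients {M : ℕ} {η : ℂ} (hη : IsPrimitiveRoot η M) (h : ℕ → ℂ) :
    ∃ w : ℕ → ℂ, ∀ s < M, h s = ∑ l ∈ Finset.range M, w l * η ^ (l * s) := by
  let v : Fin M → ℂ := fun s => η ^ (s : ℕ)
  have hv : Function.Injective v := fun a b hab => Fin.ext (hη.pow_inj a.2 b.2 hab)
  have hdet : IsUnit (Matrix.vandermonde v).det :=
    isUnit_iff_ne_zero.2 (Matrix.det_vandermonde_ne_zero_iff.2 hv)
  let w : Fin M → ℂ := (Matrix.vandermonde v)⁻¹.mulVec fun s => h s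
  have hw : (Matrix.vandermonde v).mulVec w = fun s : Fin M => h s := by
    simp only [w, Matrix.mulVec_mulVec, Matrix.mul_nonsing_inv _ hdet, Matrix.one_mulVec]
  refine ⟨fun l => if hl : l < M then w ⟨l, hl⟩ else 0, fun s hs => ?_⟩
  have := congrFun hw ⟨s, hs⟩
  simp only [Matrix.mulVec, dotProduct, Matrix.vandermonde_apply, v] at this
  rw [← this, ← Fin.sum_univ_eq_sum_range
    (fun l => (if hl : l < M then w ⟨l, hl⟩ else 0) * η ^ (l * s))]
  refine Finset.sum_congr rfl fun l _ => ?_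
  simp only [l.2, dif_pos]
  rw [← pow_mul, mul_comm, mul_comm s]

/-- Multiplication by a Hankel matrix. -/
theorem Cost.hankel (r N : ℕ) (hN : 2 * N ≤ 2 ^ r) (h : ℕ → ℂ) {u : ℕ → X → ℂ}
    (hu : ∀ t, u t ∈ B ∪ constFuns X ℂ) :
    Cost B (4 * r * 2 ^ r + 2 ^ r)
      (Set.range fun (k : Fin N) y => ∑ t ∈ Finset.range N, u t y * h (t + k)) := by
  set M := 2 ^ r with hM
  have hM0 : M ≠ 0 := by positivity
  set η := Complex.exp (2 * Real.pi * Complex.I / M)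
  have hη : IsPrimitiveRoot η M := Complex.isPrimitiveRoot_exp M hM0
  -- Expanding h gives Σ_l w_l (Σ_t u_t η^(tl)) η^(lk): two FFTs with a scaling between them. There
  -- is no wraparound, as t + k < 2N ≤ M.
  obtain ⟨w, hw⟩ := exists_fourier_coefficients hη h
  let u' : ℕ → X → ℂ := fun t => if t < N then u t else fun _ => 0
  have hu' : ∀ t, u' t ∈ B ∪ constFuns X ℂ := by
    intro t
    by_cases ht : t < N
    · simp only [u', ht, if_true]; exact hu t
    · simp only [u', ht, if_false]; exact Or.inr (const_mem_constFuns 0)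
  have c1 := Cost.fft r hη.pow_eq_one hu'
  let D : ℕ → X → ℂ := fun l y => ∑ t ∈ Finset.range M, u' t y * η ^ (t * l)
  have c2 : Cost (Set.range D) (M * 1) (Set.range fun (l : Fin M) y => w l * D l y) := by
    have := Cost.range_of_forall (B := Set.range D) (e := fun (l : Fin M) y => w l * D l y)
      (t := 1) fun l => Cost.mul (Or.inr (const_mem_constFuns _)) (Or.inl ⟨l, rfl⟩)
    rwa [Fintype.card_fin] at this
  have c3 := Cost.fft (B := Set.range fun (l : Fin M) y => w l * D l y) r hη.pow_eq_one
    (u := fun l => if l < M then fun y => w l * D l y else fun _ => 0) (by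
      intro l
      by_cases hl : l < M
      · simp only [hl, if_true]; exact Or.inl ⟨⟨l, hl⟩, rfl⟩
      · simp only [hl, if_false]; exact Or.inr (const_mem_constFuns 0))
  refine ((c1.trans c2).trans c3).mono ?_ ?_
  · rw [hM]; push_cast; ring_nf; rfl
  · rintro _ ⟨k, rfl⟩
    refine ⟨k, funext fun y => ?_⟩
    have hNM : N ≤ M := by omega
    have e1 : ∑ t ∈ Finset.range N, u t y * h (t + k) =
        ∑ t ∈ Finset.range M, u' t y * ∑ l ∈ Finset.range M, w l * η ^ (l * (t + k)) := by
      rw [← Finset.sum_subset (Finset.range_subset_range.2 hNM)]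
      · refine Finset.sum_congr rfl fun t ht => ?_
        have ht' := Finset.mem_range.1 ht
        simp only [u', ht', if_true]
        rw [hw]
        have := k.2
        omega
      · intro t _ ht
        simp only [Finset.mem_range] at ht
        simp [u', ht]
    refine Eq.trans ?_ e1.symm
    simp only [Finset.mul_sum]
    rw [Finset.sum_comm]
    refine Finset.sum_congr rfl fun l hl => ?_
    simp only [Finset.mem_range.1 hl, if_true, D, Finset.mul_sum, Finset.sum_mul]
    refine Finset.sum_congr rfl fun t _ => ?_
    rw [mul_add, pow_add, mul_comm t l]
    ring

/-- Binomials in place of squares avoid a square root of ζ in Bluestein's trick. -/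
theorem choose_two_add (k t : ℕ) : (t + k).choose 2 = k.choose 2 + t.choose 2 + t * k := by
  induction t with
  | zero => simp
  | succ t ih =>
    rw [Nat.add_right_comm, Nat.choose_succ_succ' (t + k), ih, Nat.choose_succ_succ' t]
    simp
    ring

/-- Bluestein's algorithm. -/
theorem Cost.chirp (r N : ℕ) (hN : 2 * N ≤ 2 ^ r) {ζ : ℂ} (hζ : ζ ≠ 0) {c : ℕ → X → ℂ}
    (hc : ∀ t, c t ∈ B ∪ constFuns X ℂ) :
    Cost B (4 * r * 2 ^ r + 2 ^ r + 2 * N)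
      (Set.range fun (k : Fin N) y => ∑ t ∈ Finset.range N, c t y * ζ ^ (t * (k : ℕ))) := by
  -- Writing tk = C(t+k,2) − C(t,2) − C(k,2) turns the transform into a Hankel product between two
  -- diagonal scalings.
  let u : ℕ → X → ℂ := fun t y => c t y * (ζ ^ t.choose 2)⁻¹
  have c1 : Cost B (N * 1) (Set.range fun t : Fin N => u t) := by
    have := Cost.range_of_forall (B := B) (e := fun (t : Fin N) => u t)
      (t := 1) fun t => Cost.mul (hc t) (Or.inr (const_mem_constFuns _))
    rwa [Fintype.card_fin] at this
  have c2 := Cost.hankel (B := Set.range fun t : Fin N => u t) r N hN (fun s => ζ ^ s.choose 2)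
    (u := fun t => if t < N then u t else fun _ => 0) (by
      intro t
      by_cases ht : t < N
      · simp only [ht, if_true]; exact Or.inl ⟨⟨t, ht⟩, rfl⟩
      · simp only [ht, if_false]; exact Or.inr (const_mem_constFuns 0))
  let H : Fin N → X → ℂ := fun k y =>
    ∑ t ∈ Finset.range N, (if t < N then u t else fun _ => 0) y * ζ ^ (t + (k : ℕ)).choose 2
  have c3 : Cost (Set.range H) (N * 1)
      (Set.range fun (k : Fin N) y => (ζ ^ (k : ℕ).choose 2)⁻¹ * H k y) := by
    have := Cost.range_of_forall (B := Set.range H)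
      (e := fun (k : Fin N) y => (ζ ^ (k : ℕ).choose 2)⁻¹ * H k y)
      (t := 1) fun k => Cost.mul (Or.inr (const_mem_constFuns _)) (Or.inl ⟨k, rfl⟩)
    rwa [Fintype.card_fin] at this
  refine ((c1.trans c2).trans c3).mono (by ring_nf; rfl) ?_
  rintro _ ⟨k, rfl⟩
  refine ⟨k, funext fun y => ?_⟩
  simp only [H, Finset.mul_sum]
  refine Finset.sum_congr rfl fun t ht => ?_
  simp only [Finset.mem_range.1 ht, if_true, u, choose_two_add, pow_add]
  have h1 : ζ ^ t.choose 2 ≠ 0 := pow_ne_zero _ hζ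
  have h2 : ζ ^ (k : ℕ).choose 2 ≠ 0 := pow_ne_zero _ hζ
  field_simp

end FFT

-- In an abelian group every ρ(g) is an intertwiner, so Schur's lemma applies.
open Representation in
theorem IrrepSystem.exists_scalar {A : Type*} [CommGroup A] (R : IrrepSystem A) (i : Fin R.num)
    (g : A) : ∃ l : ℂ, (R.rep i).mat g = l • (1 : Matrix _ _ ℂ) := by
  have := R.irreducible i
  obtain ⟨l, hl⟩ := IsIrreducible.algebraMap_intertwiningMap_bijective_of_isAlgClosed.surjective
    (IntertwiningMap.centralMul (R.rep i) g (by simp))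
  refine ⟨l, ?_⟩
  have : (algebraMap ℂ (IntertwiningMap (R.rep i) (R.rep i)) l).toLinearMap =
    l • LinearMap.id := rfl
  have h2 : R.rep i g = l • LinearMap.id := by
    rw [← this, hl]; rfl
  rw [mat, h2, map_smul, LinearMap.toMatrix'_id]

-- A generator acts on each irreducible by a scalar ζ^k, so every diagonal output is one of the
-- chirp sums and every off-diagonal output is zero. That the irreducibles have dimension one is
-- never needed.
open Representation in
theorem hasGeneralizedDFT_of_isCyclic {A : Type*} [CommGroup A] [Fintype A] [IsCyclic A] (r : ℕ)
    (hr : 2 * Fintype.card A ≤ 2 ^ r) :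
    HasGeneralizedDFT A (4 * r * 2 ^ r + 2 ^ r + 2 * Fintype.card A) := by
  classical
  refine ⟨nonempty_irrepSystem A, fun R => ?_⟩
  rw [computableWithin_iff_cost]
  obtain ⟨g, hg⟩ := IsCyclic.exists_generator (α := A)
  set N := Fintype.card A with hN
  have hN0 : N ≠ 0 := Fintype.card_ne_zero
  have : NeZero N := ⟨hN0⟩
  have hord : orderOf g = N := by
    rw [orderOf_eq_card_of_forall_mem_zpowers hg, Nat.card_eq_fintype_card]
  set ζ := Complex.exp (2 * Real.pi * Complex.I / N)
  have hζ : IsPrimitiveRoot ζ N := Complex.isPrimitiveRoot_exp N hN0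
  choose l hl using fun i => R.exists_scalar i g
  have hpow : ∀ i (t : ℕ), (R.rep i).mat (g ^ t) = l i ^ t • (1 : Matrix _ _ ℂ) := by
    intro i t
    induction t with
    | zero => simp [mat_one]
    | succ t ih => rw [pow_succ, mat_mul, ih, hl, pow_succ, smul_mul_smul_comm, mul_one]
  have hl1 : ∀ i, l i ^ N = 1 := by
    intro i
    have h := hpow i N
    rw [← hord, pow_orderOf_eq_one, mat_one, hord] at h
    have := congrFun (congrFun h ⟨0, R.one_le_dim i⟩) ⟨0, R.one_le_dim i⟩
    simpa using this.symm
  choose k hk hkl using fun i => hζ.eq_pow_of_pow_eq_one (hl1 i)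
  have key := Cost.chirp (B := coordFuns A ℂ) r N hr (hζ.ne_zero hN0)
    (c := fun t y => y (g ^ t)) (fun t => Or.inl ⟨g ^ t, rfl⟩)
  obtain ⟨m, B', h1, h2, h3⟩ := key
  refine ⟨m, B', h1, h2, ?_⟩
  rintro _ ⟨⟨i, a, b⟩, rfl⟩
  have e : (fun y => R.dft y ⟨i, a, b⟩) = fun y => ∑ t ∈ Finset.range N,
      y (g ^ t) * (ζ ^ (t * k i) * (1 : Matrix (Fin (R.dim i)) (Fin (R.dim i)) ℂ) a b) := by
    funext y
    rw [IrrepSystem.dft_apply, ← Fin.sum_univ_eq_sum_range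
      (fun t => y (g ^ t) * (ζ ^ (t * k i) * (1 : Matrix (Fin (R.dim i)) (Fin (R.dim i)) ℂ) a b))]
    have hbij : Function.Bijective fun t : Fin N => g ^ (t : ℕ) := by
      rw [Fintype.bijective_iff_injective_and_card]
      refine ⟨fun s t hst => Fin.ext ?_, by simp [hN]⟩
      exact pow_injOn_Iio_orderOf (by simp [hord]) (by simp [hord]) hst
    rw [← hbij.sum_comp]
    refine Finset.sum_congr rfl fun t _ => ?_
    rw [hpow, ← hkl, Matrix.smul_apply, smul_eq_mul, ← pow_mul, mul_comm (k i)]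
  by_cases hab : a = b
  · have := h3 ⟨⟨k i, hk i⟩, rfl⟩
    rw [show (fun o y => R.dft y o) ⟨i, a, b⟩ = _ from e]
    subst hab
    simpa only [Matrix.one_apply_eq, mul_one] using this
  · rw [show (fun o y => R.dft y o) ⟨i, a, b⟩ = _ from e]
    refine Or.inr ⟨0, ?_⟩
    simp [hab]

/-- A constant for the generalized DFT of cyclic groups with exponent `α`. -/
noncomputable def cyclicRate (α : ℝ) : ℝ := 6 + 16 * 4 ^ (α - 1) / ((α - 1) * Real.log 2)

theorem DFTRate.of_isCyclic {α : ℝ} (hα : 1 < α) (A : Type*) [CommGroup A] [Fintype A]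
    [IsCyclic A] : DFTRate α A (cyclicRate α) := by
  set N := Fintype.card A with hN
  have hN1 : 1 ≤ N := Fintype.card_pos
  have hN' : (1 : ℝ) ≤ N := by exact_mod_cast hN1
  -- With 2^r ≤ 4N, the terms 2^r + 2N give the 6 in `cyclicRate`; 4r·2^r ≤ 16rN together with r ≤
  -- (4N)^δ/(δ log 2) gives the other summand.
  set r := Nat.log 2 (2 * N) + 1
  have hr1 : 2 * N ≤ 2 ^ r := (Nat.lt_pow_succ_log_self (by norm_num) _).le
  have hr2 : 2 ^ r ≤ 4 * N := by
    have := Nat.pow_log_le_self 2 (show 2 * N ≠ 0 by omega)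
    rw [pow_succ]; omega
  have h := hasGeneralizedDFT_of_isCyclic (A := A) r hr1
  refine ⟨h.1, fun R => ?_⟩
  obtain ⟨m, P, out, hm, hP⟩ := h.2 R
  refine ⟨m, P, out, hm.trans ?_, hP⟩
  rw [← hN]
  set δ := α - 1 with hδ
  have hδ0 : 0 < δ := by rw [hδ]; linarith
  have hr2' : (2 : ℝ) ^ r ≤ 4 * N := by exact_mod_cast hr2
  have hlog2 : 0 < Real.log 2 := Real.log_pos (by norm_num)
  have hlog : (r : ℝ) ≤ 4 ^ δ * (N : ℝ) ^ δ / (δ * Real.log 2) := by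
    have h1 : (r : ℝ) * Real.log 2 = Real.log ((2 : ℝ) ^ r) := by rw [Real.log_pow]
    have h2 := Real.log_le_rpow_div (show (0 : ℝ) ≤ 2 ^ r by positivity) hδ0
    have h3 : ((2 : ℝ) ^ r) ^ δ ≤ (4 * N) ^ δ := by gcongr
    rw [Real.mul_rpow (by norm_num) (by positivity)] at h3
    rw [le_div_iff₀ (by positivity), mul_comm δ, ← mul_assoc, h1, ← le_div_iff₀ hδ0]
    exact h2.trans (by gcongr)
  have hNα : (N : ℝ) * (N : ℝ) ^ δ = (N : ℝ) ^ α := mul_rpow_sub_one hN1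
  have hNle : (N : ℝ) ≤ (N : ℝ) ^ α := card_le_rpow hα.le A
  calc 4 * (r : ℝ) * 2 ^ r + 2 ^ r + 2 * N
      ≤ 4 * (4 ^ δ * (N : ℝ) ^ δ / (δ * Real.log 2)) * (4 * N) + 4 * N + 2 * N := by gcongr
    _ = 6 * N + 16 * 4 ^ δ / (δ * Real.log 2) * (N * (N : ℝ) ^ δ) := by ring
    _ ≤ 6 * (N : ℝ) ^ α + 16 * 4 ^ δ / (δ * Real.log 2) * (N : ℝ) ^ α := by
      rw [hNα]; gcongr
    _ = _ := by rw [cyclicRate]; ring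

/-! ### Abelian groups -/

theorem cyclicRate_nonneg {α : ℝ} (hα : 1 < α) : 0 ≤ cyclicRate α := by
  have : 0 < Real.log 2 := Real.log_pos (by norm_num)
  have : 0 ≤ α - 1 := by linarith
  unfold cyclicRate
  positivity

section Abelian

variable {C α : ℝ}

theorem DFTRate.pi_zmod (hC : 1 ≤ C) (hα : 1 < α) (hM : MatMulRate C (2 * α)) (k : ℕ)
    (n : Fin k → ℕ) (hn : ∀ i, 1 < n i) [Fintype (∀ i, Multiplicative (ZMod (n i)))] :
    DFTRate α (∀ i, Multiplicative (ZMod (n i))) ((k + 1) * (cyclicRate α + 7 * C)) := by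
  induction k with
  | zero =>
    refine (DFTRate.of_isCyclic hα _).mono ?_
    simp
    linarith
  | succ k ih =>
    have : ∀ i, NeZero (n i) := fun i => ⟨by have := hn i; omega⟩
    have : ∀ i, Finite (Multiplicative (ZMod (n i))) := fun i => inferInstanceAs (Finite (ZMod _))
    let _ := Fintype.ofFinite (Multiplicative (ZMod (n 0)))
    let _ := Fintype.ofFinite (∀ i : Fin k, Multiplicative (ZMod (n i.succ)))
    have h1 := ih (fun i => n i.succ) fun i => hn i.succ
    have h2 := DFTRate.of_isCyclic hα (Multiplicative (ZMod (n 0)))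
    let φ : Multiplicative (ZMod (n 0)) →* ∀ i, Multiplicative (ZMod (n i)) :=
      { toFun := fun a => Fin.cons a 1
        map_one' := by
          funext i; refine Fin.cases ?_ (fun i => ?_) i <;> simp
        map_mul' := fun a b => by
          funext i; refine Fin.cases ?_ (fun i => ?_) i <;> simp }
    let ψ : (∀ i : Fin k, Multiplicative (ZMod (n i.succ))) →*
        ∀ i, Multiplicative (ZMod (n i)) :=
      { toFun := fun v => Fin.cons 1 v
        map_one' := by
          funext i; refine Fin.cases ?_ (fun i => ?_) i <;> simp
        map_mul' := fun a b => by
          funext i; refine Fin.cases ?_ (fun i => ?_) i <;> simp }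
    have hmul : ∀ a v, φ a * ψ v = Fin.cons a v := by
      intro a v
      funext i
      refine Fin.cases ?_ (fun i => ?_) i <;> simp [φ, ψ]
    refine (DFTRate.of_factorization hC hα.le hM h2 h1 φ ψ ⟨?_, ?_⟩).mono ?_
    · rintro ⟨a, v⟩ ⟨b, w⟩ h
      simp only [hmul, Fin.cons_inj] at h
      exact Prod.ext h.1 h.2
    · intro f
      exact ⟨(f 0, fun i => f i.succ), by simp only [hmul]; exact Fin.cons_self_tail f⟩
    · push_cast; linarith

/-- An isomorphism is a factorization with trivial second factor; the additive loss is harmless. -/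
theorem DFTRate.of_mulEquiv {G H : Type*} [Group G] [Fintype G] [Group H] [Fintype H] {t : ℝ}
    (hC : 1 ≤ C) (hα : 1 < α) (hM : MatMulRate C (2 * α)) (h : DFTRate α G t) (e : G ≃* H) :
    DFTRate α H (t + cyclicRate α + 7 * C) := by
  refine DFTRate.of_factorization hC hα.le hM h (DFTRate.of_isCyclic hα Unit) e.toMonoidHom 1
    ⟨?_, ?_⟩
  · rintro ⟨a, _⟩ ⟨b, _⟩ h
    simpa using h
  · intro g
    exact ⟨(e.symm g, ()), by simp⟩

/-- Each nontrivial cyclic factor has order at least 2, so there are at most log₂ |A| of them. -/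
theorem DFTRate.of_commGroup (hC : 1 ≤ C) (hα : 1 < α) (hM : MatMulRate C (2 * α))
    (A : Type*) [CommGroup A] [Fintype A] :
    DFTRate α A ((Real.logb 2 (Fintype.card A) + 2) * (cyclicRate α + 7 * C)) := by
  obtain ⟨ι, _, n, hn, ⟨e⟩⟩ := CommGroup.equiv_prod_multiplicative_zmod_of_finite A
  let k := Fintype.card ι
  let ε : ι ≃ Fin k := Fintype.equivFin ι
  let E : (∀ i, Multiplicative (ZMod (n i))) ≃* ∀ j : Fin k, Multiplicative (ZMod (n (ε.symm j))) :=
    { Equiv.piCongrLeft' (fun i => Multiplicative (ZMod (n i))) ε with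
      map_mul' := fun _ _ => rfl }
  let E' := (e.trans E).symm
  let _ := Fintype.ofEquiv A (e.trans E).toEquiv
  have h := DFTRate.of_mulEquiv hC hα hM
    (DFTRate.pi_zmod hC hα hM k (fun j => n (ε.symm j)) fun j => hn _) E'
  have hK : 0 ≤ cyclicRate α + 7 * C := by have := cyclicRate_nonneg hα; linarith
  refine h.mono ?_
  have hk : (k : ℝ) ≤ Real.logb 2 (Fintype.card A) := by
    have h1 : 2 ^ k ≤ Fintype.card A := by
      rw [← Nat.card_eq_fintype_card, Nat.card_congr e.toEquiv, Nat.card_pi]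
      calc 2 ^ k = ∏ _i : ι, 2 := by simp [k]
        _ ≤ _ := Finset.prod_le_prod' fun i _ => by
          rw [Nat.card_congr Multiplicative.toAdd, Nat.card_zmod]; exact hn i
    rw [Real.le_logb_iff_rpow_le (by norm_num) (by exact_mod_cast Fintype.card_pos),
      Real.rpow_natCast]
    exact_mod_cast h1
  nlinarith

end Abelian

/-! ### Block decomposition of special linear groups -/

namespace Matrix.SpecialLinearGroup

variable {m F : Type*} [Fintype m] [DecidableEq m] [Field F]

/-- Lower unipotent matrices with one nontrivial column. -/
def lowerHom : Multiplicative (m → F) →* SpecialLinearGroup (Unit ⊕ m) F where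
  toFun v := ⟨fromBlocks 1 0 (replicateCol Unit v.toAdd) 1, by simp⟩
  map_one' := by ext (i | i) (j | j) <;> simp [Matrix.one_apply]
  map_mul' v w := by
    apply Subtype.ext
    change _ = fromBlocks _ _ _ _ * fromBlocks _ _ _ _
    simp [fromBlocks_multiply, replicateCol_add]

/-- Upper unipotent matrices with one nontrivial row. -/
def upperHom : Multiplicative (m → F) →* SpecialLinearGroup (Unit ⊕ m) F where
  toFun v := ⟨fromBlocks 1 (replicateRow Unit v.toAdd) 0 1, by simp⟩
  map_one' := by ext (i | i) (j | j) <;> simp [Matrix.one_apply]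
  map_mul' v w := by
    apply Subtype.ext
    change _ = fromBlocks _ _ _ _ * fromBlocks _ _ _ _
    simp [fromBlocks_multiply, replicateRow_add, add_comm]

/-- The inclusion of the lower right block. -/
def blockHom : SpecialLinearGroup m F →* SpecialLinearGroup (Unit ⊕ m) F where
  toFun g := ⟨fromBlocks 1 0 0 g.1, by simp⟩
  map_one' := by apply Subtype.ext; simp
  map_mul' g h := by
    apply Subtype.ext
    change _ = fromBlocks _ _ _ _ * fromBlocks _ _ _ _
    simp [fromBlocks_multiply]

/-- The diagonal matrices `diag (a, a⁻¹, 1, …)`. -/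
def torusHom (i₀ : m) : Fˣ →* SpecialLinearGroup (Unit ⊕ m) F where
  toFun a := ⟨fromBlocks (diagonal fun _ => (a : F)) 0 0
    (diagonal (Pi.mulSingle i₀ ((a⁻¹ : Fˣ) : F))), by
      simp [Finset.prod_pi_mulSingle']⟩
  map_one' := by apply Subtype.ext; simp
  map_mul' a b := by
    apply Subtype.ext
    change fromBlocks (diagonal fun _ => ((a * b : Fˣ) : F)) 0 0
      (diagonal (Pi.mulSingle i₀ (((a * b)⁻¹ : Fˣ) : F))) = fromBlocks _ _ _ _ * fromBlocks _ _ _ _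
    rw [mul_inv, Units.val_mul, Units.val_mul, Pi.mulSingle_mul]
    simp only [fromBlocks_multiply, diagonal_mul_diagonal, Matrix.mul_zero, Matrix.zero_mul,
      add_zero, zero_add]
    rfl

theorem coe_lowerHom (v : Multiplicative (m → F)) :
    (lowerHom v).1 = fromBlocks 1 0 (replicateCol Unit v.toAdd) 1 := rfl

theorem coe_upperHom (v : Multiplicative (m → F)) :
    (upperHom v).1 = fromBlocks 1 (replicateRow Unit v.toAdd) 0 1 := rfl

theorem coe_blockHom (g : SpecialLinearGroup m F) : (blockHom g).1 = fromBlocks 1 0 0 g.1 := rfl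

theorem coe_torusHom (i₀ : m) (a : Fˣ) : (torusHom i₀ a).1 =
    fromBlocks (diagonal fun _ => (a : F)) 0 0 (diagonal (Pi.mulSingle i₀ ((a⁻¹ : Fˣ) : F))) := rfl

/-- The first basis vector. -/
def firstVec : Unit ⊕ m → F := Pi.single (Sum.inl ()) 1

theorem mulVec_firstVec (g : SpecialLinearGroup (Unit ⊕ m) F) :
    g.1.mulVec firstVec = fun i => g.1 i (Sum.inl ()) := by
  simp [firstVec]
  rfl

/-- The matrices having the first basis vector as an eigenvector, with eigenvalue in `S`. -/
def firstStabilizer (m : Type*) [Fintype m] [DecidableEq m] (S : Subgroup Fˣ) :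
    Subgroup (SpecialLinearGroup (Unit ⊕ m) F) where
  carrier := {g | ∃ a ∈ S, g.1.mulVec firstVec = (a : F) • firstVec}
  one_mem' := ⟨1, S.one_mem, by simp⟩
  mul_mem' := by
    rintro g h ⟨a, ha, hga⟩ ⟨b, hb, hhb⟩
    refine ⟨a * b, S.mul_mem ha hb, ?_⟩
    simp only [coe_mul, ← mulVec_mulVec]
    rw [hhb, mulVec_smul, hga, smul_smul, mul_comm, Units.val_mul]
  inv_mem' := by
    rintro g ⟨a, ha, hga⟩
    refine ⟨a⁻¹, S.inv_mem ha, ?_⟩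
    have h := congrArg (g⁻¹.1.mulVec) hga
    rw [mulVec_mulVec, ← coe_mul, inv_mul_cancel, coe_one, one_mulVec, mulVec_smul] at h
    calc _ = ((a⁻¹ : Fˣ) : F) • ((a : F) • g⁻¹.1.mulVec firstVec) := by
          rw [smul_smul, Units.inv_mul, one_smul]
      _ = _ := by rw [← h]

theorem lowerHom_mulVec (v : Multiplicative (m → F)) :
    (lowerHom v).1.mulVec firstVec = Sum.elim (fun _ => 1) v.toAdd := by
  rw [mulVec_firstVec]
  funext i
  rcases i with i | i <;> simp [coe_lowerHom]

theorem upperHom_mulVec (v : Multiplicative (m → F)) :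
    (upperHom v).1.mulVec firstVec = firstVec := by
  rw [mulVec_firstVec]
  funext i
  rcases i with i | i <;> simp [coe_upperHom, firstVec]

theorem blockHom_mulVec (g : SpecialLinearGroup m F) :
    (blockHom g).1.mulVec firstVec = firstVec := by
  rw [mulVec_firstVec]
  funext i
  rcases i with i | i <;> simp [coe_blockHom, firstVec]

theorem torusHom_mulVec (i₀ : m) (a : Fˣ) :
    (torusHom i₀ a).1.mulVec firstVec = (a : F) • firstVec := by
  rw [mulVec_firstVec]
  funext i
  rcases i with i | i <;> simp [coe_torusHom, firstVec]

theorem upperHom_mem (S : Subgroup Fˣ) (v : Multiplicative (m → F)) :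
    upperHom v ∈ firstStabilizer m S :=
  ⟨1, S.one_mem, by rw [upperHom_mulVec, Units.val_one, one_smul]⟩

theorem blockHom_mem (S : Subgroup Fˣ) (g : SpecialLinearGroup m F) :
    blockHom g ∈ firstStabilizer m S :=
  ⟨1, S.one_mem, by rw [blockHom_mulVec, Units.val_one, one_smul]⟩

theorem torusHom_mem (i₀ : m) (a : Fˣ) : torusHom i₀ a ∈ firstStabilizer m (⊤ : Subgroup Fˣ) :=
  ⟨a, Subgroup.mem_top _, torusHom_mulVec i₀ a⟩

/-- Eigenvalue 1 forces the first column to be the first basis vector, and then the lower right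
block has determinant 1. -/
theorem bijective_block_mul_upper :
    Function.Bijective fun p : SpecialLinearGroup m F × Multiplicative (m → F) =>
      blockHom.codRestrict (firstStabilizer m (⊥ : Subgroup Fˣ)) (blockHom_mem ⊥) p.1 *
        upperHom.codRestrict (firstStabilizer m (⊥ : Subgroup Fˣ)) (upperHom_mem ⊥) p.2 := by
  have hmul : ∀ (g : SpecialLinearGroup m F) v, (blockHom g * upperHom v).1 =
      fromBlocks 1 (replicateRow Unit v.toAdd) 0 g.1 := by
    intro g v
    change fromBlocks _ _ _ _ * fromBlocks _ _ _ _ = _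
    simp [fromBlocks_multiply]
  constructor
  · rintro ⟨g, v⟩ ⟨h, w⟩ e
    have e' : (blockHom g * upperHom v).1 = (blockHom h * upperHom w).1 :=
      congrArg (fun x => x.1.1) e
    rw [hmul, hmul, fromBlocks_inj] at e'
    exact Prod.ext (Subtype.ext e'.2.2.2) (replicateRow_injective e'.2.1)
  · rintro ⟨x, a, ha, hx⟩
    rw [Subgroup.mem_bot] at ha
    subst ha
    rw [mulVec_firstVec] at hx
    have hblk : x.1 = fromBlocks 1 (replicateRow Unit fun j => x.1 (Sum.inl ()) (Sum.inr j)) 0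
        x.1.toBlocks₂₂ := by
      ext (i | i) (j | j)
      · simpa [firstVec] using congrFun hx (Sum.inl ())
      · rfl
      · simpa [firstVec] using congrFun hx (Sum.inr i)
      · rfl
    have hdet : x.1.toBlocks₂₂.det = 1 := by
      have := x.2
      rw [hblk] at this
      simpa using this
    refine ⟨(⟨_, hdet⟩, Multiplicative.ofAdd fun j => x.1 (Sum.inl ()) (Sum.inr j)), ?_⟩
    apply Subtype.ext
    apply Subtype.ext
    exact (hmul _ _).trans hblk.symm

omit [Fintype m] in
theorem firstVec_ne_zero : (firstVec : Unit ⊕ m → F) ≠ 0 := fun h => by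
  have := congrFun h (Sum.inl ())
  simp [firstVec] at this

theorem firstStabilizer_mono {S T : Subgroup Fˣ} (h : S ≤ T) :
    firstStabilizer m S ≤ firstStabilizer m T := fun _ ⟨a, ha, hx⟩ => ⟨a, h ha, hx⟩

/-- The eigenvalue determines the torus factor. The index `i₀` holds the compensating a⁻¹, so a
nonempty block is required. -/
theorem bijective_torus_mul (i₀ : m) :
    Function.Bijective fun p : Fˣ × firstStabilizer m (⊥ : Subgroup Fˣ) =>
      (torusHom i₀).codRestrict (firstStabilizer m (⊤ : Subgroup Fˣ)) (torusHom_mem i₀) p.1 *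
        Subgroup.inclusion (firstStabilizer_mono bot_le) p.2 := by
  have hmul : ∀ (a : Fˣ) (g : firstStabilizer m (⊥ : Subgroup Fˣ)),
      (torusHom i₀ a * g.1).1.mulVec firstVec = (a : F) • firstVec := by
    rintro a ⟨g, b, hb, hg⟩
    rw [Subgroup.mem_bot] at hb
    subst hb
    simp only [coe_mul, ← mulVec_mulVec]
    rw [hg, Units.val_one, one_smul, torusHom_mulVec]
  constructor
  · rintro ⟨a, g⟩ ⟨b, h⟩ e
    have e' : torusHom i₀ a * g.1 = torusHom i₀ b * h.1 := congrArg Subtype.val e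
    have hab : a = b := by
      have := congrArg (fun x => x.1.mulVec firstVec) e'
      simp only [hmul] at this
      exact Units.ext (smul_left_injective F firstVec_ne_zero this)
    subst hab
    exact Prod.ext rfl (Subtype.ext (mul_left_cancel e'))
  · rintro ⟨x, a, ha, hx⟩
    refine ⟨(a, ⟨(torusHom i₀ a)⁻¹ * x, 1, Subgroup.one_mem _, ?_⟩), ?_⟩
    · rw [coe_mul, ← mulVec_mulVec, hx, ← torusHom_mulVec i₀ a, mulVec_mulVec, ← coe_mul,
        inv_mul_cancel]
      simp
    · apply Subtype.ext
      simp

/-- The first column of the product is a · (1, v), from which a and v are recovered. -/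
theorem injective_lower_mul :
    Function.Injective fun p : Multiplicative (m → F) × firstStabilizer m (⊤ : Subgroup Fˣ) =>
      lowerHom p.1 * (firstStabilizer m (⊤ : Subgroup Fˣ)).subtype p.2 := by
  rintro ⟨v, ⟨g, a, ha, hg⟩⟩ ⟨w, ⟨h, b, hb, hh⟩⟩ e
  simp only [Subgroup.coe_subtype] at e
  have e' := congrArg (fun x => x.1.mulVec firstVec) e
  simp only [coe_mul, ← mulVec_mulVec, hg, hh, mulVec_smul, lowerHom_mulVec] at e'
  have hab : (a : F) = b := by simpa using congrFun e' (Sum.inl ())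
  have hvw : v = w := by
    apply Multiplicative.toAdd.injective
    funext i
    have := congrFun e' (Sum.inr i)
    simp only [Pi.smul_apply, Sum.elim_inr, smul_eq_mul, hab] at this
    exact mul_left_cancel₀ b.ne_zero this
  subst hvw
  exact Prod.ext rfl (Subtype.ext (mul_left_cancel e))

theorem exists_eq_lower_mul {x : SpecialLinearGroup (Unit ⊕ m) F}
    (hx : x.1 (Sum.inl ()) (Sum.inl ()) ≠ 0) :
    ∃ v, ∃ p : firstStabilizer m (⊤ : Subgroup Fˣ), x = lowerHom v * p.1 := by
  set a := x.1 (Sum.inl ()) (Sum.inl ())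
  let v : Multiplicative (m → F) :=
    Multiplicative.ofAdd fun i => x.1 (Sum.inr i) (Sum.inl ()) * a⁻¹
  refine ⟨v, ⟨(lowerHom v)⁻¹ * x, Units.mk0 a hx, Subgroup.mem_top _, ?_⟩, by simp⟩
  have h1 : x.1.mulVec firstVec = a • (lowerHom v).1.mulVec firstVec := by
    rw [mulVec_firstVec, lowerHom_mulVec]
    funext i
    rcases i with i | i
    · simp [a]
    · simp only [v, Pi.smul_apply, Sum.elim_inr, toAdd_ofAdd, smul_eq_mul]
      field_simp
  rw [coe_mul, ← mulVec_mulVec, h1, mulVec_smul, mulVec_mulVec, ← coe_mul, inv_mul_cancel]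
  simp

/-- Translates of the big cell covering the group. -/
def cellTranslate : Option m → SpecialLinearGroup (Unit ⊕ m) F
  | none => 1
  | some i => (upperHom (Multiplicative.ofAdd (Pi.single i 1)))⁻¹

/-- If the corner entry vanishes, another entry of the first column does not, as the determinant is
1; adding its row to the first row moves x into the big cell. -/
theorem exists_eq_cellTranslate_mul (x : SpecialLinearGroup (Unit ⊕ m) F) :
    ∃ j v, ∃ p : firstStabilizer m (⊤ : Subgroup Fˣ), x = cellTranslate j * lowerHom v * p.1 := by
  by_cases h0 : x.1 (Sum.inl ()) (Sum.inl ()) = 0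
  · obtain ⟨i, hi⟩ : ∃ i, x.1 (Sum.inr i) (Sum.inl ()) ≠ 0 := by
      by_contra! h
      have hcol : ∀ i, x.1 i (Sum.inl ()) = 0 := by
        rintro (i | i)
        · exact h0
        · exact h i
      have := x.2
      rw [det_eq_zero_of_column_eq_zero _ hcol] at this
      exact zero_ne_one this
    have hne : (upperHom (Multiplicative.ofAdd (Pi.single i 1)) * x).1 (Sum.inl ()) (Sum.inl ())
        ≠ 0 := by
      simpa [coe_upperHom, mul_apply, Fintype.sum_sum_type, h0, Pi.single_apply] using hi
    obtain ⟨v, p, hvp⟩ := exists_eq_lower_mul hne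
    refine ⟨some i, v, p, ?_⟩
    rw [cellTranslate, mul_assoc, ← hvp, inv_mul_cancel_left]
  · obtain ⟨v, p, hvp⟩ := exists_eq_lower_mul h0
    exact ⟨none, v, p, by rw [cellTranslate, one_mul, hvp]⟩

/-- Reindexing of the rows and columns. -/
def reindexEquiv {m' : Type*} [Fintype m'] [DecidableEq m'] (e : m ≃ m') :
    SpecialLinearGroup m F ≃* SpecialLinearGroup m' F where
  toFun g := ⟨Matrix.reindex e e g.1, by rw [det_reindex_self]; exact g.2⟩
  invFun g := ⟨Matrix.reindex e.symm e.symm g.1, by rw [det_reindex_self]; exact g.2⟩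
  left_inv g := by apply Subtype.ext; simp
  right_inv g := by apply Subtype.ext; simp
  map_mul' g h := by
    apply Subtype.ext
    change _ = Matrix.reindex _ _ _ * Matrix.reindex _ _ _
    simp [Matrix.submatrix_mul_equiv]

end Matrix.SpecialLinearGroup

/-! ### Special linear groups over finite fields -/

-- Each step gains a lower column and an upper row, that is q^(2n), and n(n−1) + 2n = (n+1)n; the
-- torus is discarded.
open Matrix.SpecialLinearGroup in
theorem pow_le_card_specialLinearGroup (n : ℕ) (F : Type*) [Field F] [Fintype F] [DecidableEq F] :
    Fintype.card F ^ (n * (n - 1)) ≤ Fintype.card (Matrix.SpecialLinearGroup (Fin n) F) := by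
  induction n with
  | zero => exact Fintype.card_pos (α := Matrix.SpecialLinearGroup (Fin 0) F)
  | succ n ih =>
    let _ := Fintype.ofFinite (firstStabilizer (Fin n) (⊥ : Subgroup Fˣ))
    let _ := Fintype.ofFinite (firstStabilizer (Fin n) (⊤ : Subgroup Fˣ))
    have h1 := Fintype.card_le_of_injective _ (injective_lower_mul (m := Fin n) (F := F))
    have h2 := Fintype.card_le_of_injective _ (bijective_block_mul_upper (m := Fin n) (F := F)).1
    have h3 : Fintype.card (firstStabilizer (Fin n) (⊥ : Subgroup Fˣ)) ≤
        Fintype.card (firstStabilizer (Fin n) (⊤ : Subgroup Fˣ)) :=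
      Fintype.card_le_of_injective _ (Subgroup.inclusion_injective (firstStabilizer_mono bot_le))
    have h4 : Fintype.card (Matrix.SpecialLinearGroup (Unit ⊕ Fin n) F) =
        Fintype.card (Matrix.SpecialLinearGroup (Fin (n + 1)) F) :=
      Fintype.card_congr (reindexEquiv (Fintype.equivOfCardEq (by simp [add_comm]))).toEquiv
    have hV : Fintype.card (Multiplicative (Fin n → F)) = Fintype.card F ^ n := by
      rw [Fintype.card_congr Multiplicative.toAdd]; simp
    rw [Fintype.card_prod, hV] at h1 h2
    rw [h4] at h1
    calc Fintype.card F ^ ((n + 1) * (n + 1 - 1))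
        = Fintype.card F ^ n * (Fintype.card F ^ (n * (n - 1)) * Fintype.card F ^ n) := by
          rw [← pow_add, ← pow_add]
          congr 1
          rcases n with _ | n
          · rfl
          · simp only [Nat.add_sub_cancel]; ring
      _ ≤ Fintype.card F ^ n *
          (Fintype.card (Matrix.SpecialLinearGroup (Fin n) F) * Fintype.card F ^ n) := by gcongr
      _ ≤ _ := (Nat.mul_le_mul_left _ (h2.trans h3)).trans h1

section

variable {C α : ℝ} {F : Type*} [Field F] [Fintype F] [DecidableEq F]

theorem one_le_logb_card (F : Type*) [Field F] [Fintype F] :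
    1 ≤ Real.logb 2 (Fintype.card F) := by
  have h : (2 : ℝ) ≤ Fintype.card F := by exact_mod_cast Fintype.one_lt_card (α := F)
  rw [Real.le_logb_iff_rpow_le (by norm_num) (by linarith)]
  simpa using h

open Matrix.SpecialLinearGroup in
theorem DFTRate.specialLinearGroup_succ (hC : 1 ≤ C) (hα : 1 < α) (hM : MatMulRate C (2 * α))
    {n : ℕ} (hn : 1 ≤ n) {t : ℝ} (h : DFTRate α (Matrix.SpecialLinearGroup (Fin n) F) t) :
    DFTRate α (Matrix.SpecialLinearGroup (Fin (n + 1)) F)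
      ((n + 1) * (t + (2 * n + 11) *
        (Real.logb 2 (Fintype.card F) * (cyclicRate α + 7 * C)))) := by
  let _ := Fintype.ofFinite (firstStabilizer (Fin n) (⊥ : Subgroup Fˣ))
  let _ := Fintype.ofFinite (firstStabilizer (Fin n) (⊤ : Subgroup Fˣ))
  set K := cyclicRate α + 7 * C with hK
  set L := Real.logb 2 (Fintype.card F) with hL
  have hL1 : 1 ≤ L := one_le_logb_card F
  have hcyc := cyclicRate_nonneg hα
  have hK0 : 0 ≤ K := by linarith
  have hV := DFTRate.of_commGroup hC hα hM (Multiplicative (Fin n → F))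
  have hT := DFTRate.of_commGroup hC hα hM Fˣ
  rw [Fintype.card_congr Multiplicative.toAdd] at hV
  simp only [Fintype.card_fun, Fintype.card_fin, Nat.cast_pow] at hV
  rw [Real.logb_pow, ← hL, ← hK] at hV
  have hTL : Real.logb 2 (Fintype.card Fˣ) ≤ L := by
    refine Real.logb_le_logb_of_le (by norm_num) (by exact_mod_cast Fintype.card_pos) ?_
    exact_mod_cast Fintype.card_le_of_injective _ (Units.val_injective (α := F))
  have h1 := DFTRate.of_factorization hC hα.le hM h hV _ _
    (bijective_block_mul_upper (m := Fin n) (F := F))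
  have h2 := DFTRate.of_factorization hC hα.le hM hT h1 _ _
    (bijective_torus_mul (F := F) (⟨0, hn⟩ : Fin n))
  have h3 := DFTRate.of_cover hC hα.le hM hV h2 _ _
    (injective_lower_mul (m := Fin n) (F := F)) cellTranslate exists_eq_cellTranslate_mul
  have h4 := DFTRate.of_mulEquiv hC hα hM h3
    (reindexEquiv (m' := Fin (n + 1)) (Fintype.equivOfCardEq (by simp [add_comm])))
  refine h4.mono ?_
  rw [Fintype.card_option, Fintype.card_fin]
  push_cast
  have hn0 : (0 : ℝ) ≤ n := Nat.cast_nonneg n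
  have hKL : K ≤ L * K := le_mul_of_one_le_left hK0 hL1
  have hKC : 7 * C ≤ L * K := by linarith
  have e1 : (Real.logb 2 (Fintype.card Fˣ) + 2) * K ≤ 3 * (L * K) := by
    have : Real.logb 2 (Fintype.card Fˣ) * K ≤ L * K := by gcongr
    linarith
  have e2 : (n * L + 2) * K ≤ (n + 2) * (L * K) := by nlinarith
  have hLK : 0 ≤ L * K := by positivity
  have hnLK : 0 ≤ (n : ℝ) * (L * K) := by positivity
  -- Two copies of F^n contribute 2(n+2), the torus 3, and the three terms 7C another 3, in units of
  -- LK. The final reindexing raises 2n + 10 to 2n + 11.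
  have e3 : (n * L + 2) * K + ((Real.logb 2 (Fintype.card Fˣ) + 2) * K +
      (t + (n * L + 2) * K + 7 * C) + 7 * C) + 7 * C ≤ t + (2 * n + 10) * (L * K) := by
    linarith
  calc _ ≤ ((n : ℝ) + 1) * (t + (2 * n + 10) * (L * K)) + L * K := by
        rw [add_assoc _ (cyclicRate α), ← hK]
        gcongr
    _ ≤ _ := by nlinarith

theorem DFTRate.of_subsingleton (hC : 1 ≤ C) (hα : 1 < α) (hM : MatMulRate C (2 * α))
    (G : Type*) [Group G] [Fintype G] [Subsingleton G] :
    DFTRate α G (2 * (cyclicRate α + 7 * C)) := by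
  refine (DFTRate.of_factorization hC hα.le hM (DFTRate.of_isCyclic hα Unit)
    (DFTRate.of_isCyclic hα Unit) 1 1 ⟨fun _ _ _ => Subsingleton.elim _ _,
      fun g => ⟨1, Subsingleton.elim _ _⟩⟩).mono ?_
  linarith

theorem DFTRate.specialLinearGroup (hC : 1 ≤ C) (hα : 1 < α) (hM : MatMulRate C (2 * α)) (n : ℕ) :
    DFTRate α (Matrix.SpecialLinearGroup (Fin n) F)
      (6 * (cyclicRate α + 7 * C) * (Real.logb 2 (Fintype.card F) * (n + 2).factorial)) := by
  have hcyc := cyclicRate_nonneg hα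
  have hL1 := one_le_logb_card F
  set K := cyclicRate α + 7 * C with hK
  set L := Real.logb 2 (Fintype.card F)
  have hK0 : 0 ≤ K := by linarith
  have hKL : K ≤ L * K := le_mul_of_one_le_left hK0 hL1
  have base : ∀ k : ℕ, 2 * K ≤ 6 * K * (L * (k + 2).factorial) := by
    intro k
    have hf : (1 : ℝ) ≤ (k + 2).factorial := by exact_mod_cast Nat.factorial_pos _
    have : L * K ≤ L * K * (k + 2).factorial := le_mul_of_one_le_right (by linarith) hf
    linarith
  induction n with
  | zero => exact (DFTRate.of_subsingleton hC hα hM _).mono (base 0)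
  | succ n ih =>
    rcases Nat.eq_zero_or_pos n with rfl | hn
    · have : Subsingleton (Fin (0 + 1)) := inferInstanceAs (Subsingleton (Fin 1))
      exact (DFTRate.of_subsingleton hC hα hM _).mono (base 1)
    · refine (DFTRate.specialLinearGroup_succ hC hα hM hn ih).mono ?_
      have hf : ((n : ℝ) + 2) * (n + 1) ≤ (n + 2).factorial := by
        have : (n + 2) * (n + 1) ≤ (n + 2).factorial := by
          rw [Nat.factorial_succ, Nat.factorial_succ, ← mul_assoc]
          exact Nat.le_mul_of_pos_right _ (Nat.factorial_pos n)
        exact_mod_cast this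
      rw [show n + 1 + 2 = (n + 2) + 1 by ring, Nat.factorial_succ (n + 2)]
      push_cast
      have hLK : 0 ≤ L * K := by linarith
      have hn1 : (1 : ℝ) ≤ n := by exact_mod_cast hn
      -- As (n+3)! = (n+1)(n+2)! + 2(n+2)!, the surplus 2(n+2)!, times the prefactor 6, pays for the
      -- new term.
      have key : ((n : ℝ) + 1) * (2 * n + 11) ≤ 12 * (n + 2).factorial := by nlinarith
      have := mul_le_mul_of_nonneg_right key hLK
      linarith

end

/-! ### Absorbing factorials and logarithms into |G|^ε -/

/-- Passing from n to n + 1 multiplies the left side by n + 3 and the right side by b^(2n), which is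
eventually larger; c covers the initial range. -/
theorem exists_factorial_le {b : ℝ} (hb : 1 < b) :
    ∃ c : ℝ, 1 ≤ c ∧ ∀ n : ℕ, ((n + 2).factorial : ℝ) ≤ c * b ^ (n * (n - 1)) := by
  have hb2 : 1 < b ^ 2 := one_lt_pow₀ hb two_ne_zero
  have h1 : ∀ᶠ n : ℕ in Filter.atTop, (n : ℝ) + 3 ≤ (b ^ 2) ^ n := by
    have t1 := tendsto_pow_const_div_const_pow_of_one_lt 1 hb2
    have t2 := tendsto_pow_const_div_const_pow_of_one_lt 0 hb2
    have t3 := t1.add (t2.const_mul 3)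
    simp only [mul_zero, add_zero, pow_zero, pow_one] at t3
    filter_upwards [t3.eventually_le_const zero_lt_one] with n hn
    have hp : 0 < (b ^ 2) ^ n := by positivity
    rw [mul_one_div, ← add_div, div_le_one hp] at hn
    exact hn
  obtain ⟨N, hN⟩ := Filter.eventually_atTop.1 h1
  refine ⟨(N + 2).factorial, by exact_mod_cast Nat.factorial_pos _, fun n => ?_⟩
  rcases le_total n N with h | h
  · have h2 : ((n + 2).factorial : ℝ) ≤ (N + 2).factorial := by
      exact_mod_cast Nat.factorial_le (by omega)
    exact h2.trans (le_mul_of_one_le_right (Nat.cast_nonneg _) (one_le_pow₀ hb.le))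
  · induction n, h using Nat.le_induction with
    | base => exact le_mul_of_one_le_right (Nat.cast_nonneg _) (one_le_pow₀ hb.le)
    | succ n hn ih =>
      have e : b ^ ((n + 1) * (n + 1 - 1)) = b ^ (n * (n - 1)) * (b ^ 2) ^ n := by
        rw [← pow_mul, ← pow_add]
        congr 1
        rcases n with _ | n
        · rfl
        · simp only [Nat.add_sub_cancel]; ring
      rw [e, show n + 1 + 2 = (n + 2) + 1 by ring, Nat.factorial_succ]
      push_cast
      have h3 := hN n hn
      have h4 : (0 : ℝ) ≤ (n + 2).factorial := Nat.cast_nonneg _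
      calc ((n : ℝ) + 2 + 1) * (n + 2).factorial = (n + 2).factorial * (n + 3) := by ring
        _ ≤ ((N + 2).factorial * b ^ (n * (n - 1))) * (b ^ 2) ^ n := by gcongr
        _ = _ := by ring

theorem exists_logb_mul_factorial_le {η : ℝ} (hη : 0 < η) :
    ∃ c : ℝ, 0 ≤ c ∧ ∀ n q S : ℕ, 2 ≤ n → 2 ≤ q → q ^ (n * (n - 1)) ≤ S →
      Real.logb 2 q * (n + 2).factorial ≤ c * (S : ℝ) ^ η := by
  set b : ℝ := 2 ^ η
  have hb : 1 < b := Real.one_lt_rpow (by norm_num) hη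
  obtain ⟨c, hc1, hc⟩ := exists_factorial_le hb
  have hlog2 : 0 < Real.log 2 := Real.log_pos (by norm_num)
  refine ⟨c * b / (η * Real.log 2), by positivity, fun n q S hn hq hS => ?_⟩
  have hq' : (2 : ℝ) ≤ q := by exact_mod_cast hq
  have h1 : Real.logb 2 q ≤ (q : ℝ) ^ η / (η * Real.log 2) := by
    rw [Real.logb, ← div_div]
    gcongr
    exact Real.log_le_rpow_div (by positivity) hη
  -- One factor q^η pays for log q; the other e factors, each at least b = 2^η, pay for the
  -- factorial. The missing b goes into the constant.
  obtain ⟨e, he⟩ : ∃ e, n * (n - 1) = e + 1 :=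
    Nat.exists_eq_succ_of_ne_zero (Nat.mul_ne_zero (by omega) (by omega))
  have h2 : (q : ℝ) ^ η * b ^ e ≤ (S : ℝ) ^ η := by
    have hbq : b ^ e ≤ ((q : ℝ) ^ η) ^ e := by
      have : b ≤ (q : ℝ) ^ η := Real.rpow_le_rpow (by norm_num) hq' hη.le
      gcongr
    calc (q : ℝ) ^ η * b ^ e ≤ (q : ℝ) ^ η * ((q : ℝ) ^ η) ^ e := by gcongr
      _ = ((q : ℝ) ^ (n * (n - 1))) ^ η := by
        rw [he, ← pow_succ', ← Real.rpow_natCast, ← Real.rpow_mul (by positivity), mul_comm,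
          Real.rpow_mul (by positivity), Real.rpow_natCast]
      _ ≤ _ := by
        have : (q : ℝ) ^ (n * (n - 1)) ≤ S := by exact_mod_cast hS
        gcongr
  calc Real.logb 2 q * (n + 2).factorial
      ≤ (q : ℝ) ^ η / (η * Real.log 2) * (c * b ^ (n * (n - 1))) := by
        gcongr
        exact hc n
    _ = c * b / (η * Real.log 2) * ((q : ℝ) ^ η * b ^ e) := by
        rw [he, pow_succ]; ring
    _ ≤ _ := by gcongr

theorem theorem5p4 (ε : ℝ) (hε : 0 < ε) :
    ∃ c : ℝ, ∀ (n : ℕ) (F : Type*) [Field F] [Fintype F] [DecidableEq F],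
      HasGeneralizedDFT (Matrix.SpecialLinearGroup (Fin n) F)
        (c * (Fintype.card (Matrix.SpecialLinearGroup (Fin n) F) : ℝ) ^
          (matMulExponent / 2 + ε)) := by
  -- Half of ε makes 2α exceed ω, so that a rate C exists; the other half absorbs the factorial and
  -- the logarithm.
  set α := matMulExponent / 2 + ε / 2 with hαdef
  have hω := two_le_matMulExponent
  have hα : 1 < α := by linarith
  obtain ⟨C, hC, hM⟩ := exists_matMulRate (a := 2 * α) (by linarith)
  obtain ⟨c, hc0, hc⟩ := exists_logb_mul_factorial_le (half_pos hε)
  have hK0 : 0 ≤ cyclicRate α + 7 * C := by have := cyclicRate_nonneg hα; linarith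
  set K := cyclicRate α + 7 * C with hK
  -- The summand 2K covers the trivial groups n ≤ 1.
  refine ⟨6 * K * c + 2 * K, fun n F _ _ _ => ?_⟩
  set S := Fintype.card (Matrix.SpecialLinearGroup (Fin n) F) with hS
  have hS0 : (0 : ℝ) < S := by exact_mod_cast Fintype.card_pos
  have key : ∀ t T : ℝ, DFTRate α (Matrix.SpecialLinearGroup (Fin n) F) t →
      t * (S : ℝ) ^ α ≤ T → HasGeneralizedDFT (Matrix.SpecialLinearGroup (Fin n) F) T := by
    intro t T h hT
    refine ⟨h.1, fun R => ?_⟩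
    obtain ⟨m, P, out, hm, hP⟩ := h.2 R
    exact ⟨m, P, out, hm.trans hT, hP⟩
  have hle : (S : ℝ) ^ (matMulExponent / 2 + ε) = (S : ℝ) ^ (ε / 2) * (S : ℝ) ^ α := by
    rw [← Real.rpow_add hS0]; congr 1; rw [hαdef]; ring
  have hS1 : 1 ≤ (S : ℝ) ^ (ε / 2) :=
    Real.one_le_rpow (by exact_mod_cast Fintype.card_pos) (by positivity)
  by_cases hn : 2 ≤ n
  · refine key _ _ (DFTRate.specialLinearGroup hC hα hM n) ?_
    have h1 := hc n (Fintype.card F) S hn Fintype.one_lt_card (pow_le_card_specialLinearGroup n F)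
    rw [hle, ← mul_assoc (6 * K * c + 2 * K)]
    refine mul_le_mul_of_nonneg_right ?_ (Real.rpow_nonneg hS0.le _)
    calc 6 * K * (Real.logb 2 (Fintype.card F) * (n + 2).factorial)
        ≤ 6 * K * (c * (S : ℝ) ^ (ε / 2)) := by gcongr
      _ ≤ (6 * K * c + 2 * K) * (S : ℝ) ^ (ε / 2) := by nlinarith
  · have hsub : Subsingleton (Matrix.SpecialLinearGroup (Fin n) F) := by
      interval_cases n <;> infer_instance
    refine key _ _ (DFTRate.of_subsingleton hC hα hM _) ?_
    rw [hle, ← mul_assoc (6 * K * c + 2 * K)]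
    refine mul_le_mul_of_nonneg_right ?_ (Real.rpow_nonneg hS0.le _)
    have : 0 ≤ 6 * K * c := by positivity
    nlinarith
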